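/- Let $n,k$ be integers with $1\le k\le n-1$. Let $G_{n,k}$ be the Grassmann manifold of $k$-dimensional linear subspaces $\xi$ of $\mathbb R^n$ with its $O(n)$-invariant probability measure $d\xi$, and let $\mathcal G_{n,k}$ be the manifold of all affine $k$-planes $\tau=\xi+u$ in $\mathbb R^n$, parametrized by the pairs $(\xi,u)$ with $\xi\in G_{n,k}$ and $u\in\xi^\perp$, with the measure $d\tau=d\xi\,du$, where $du$ is Lebesgue measure on $\xi^\perp$. Let $|\tau|$ be the Euclidean distance from $\tau$ to the origin. For $1\le p\le\infty$ and real $\mu,\nu$ let $L^p_\mu(\mathbb R^n)$ and $L^p_\nu(\mathcal G_{n,k})$ be the spaces of (real- or complex-valued) measurable functions with finite norm $$\|f\|_{p,\mu}=\big\||x|^\mu f\big\|_{L^p(\mathbb R^n)},\qquad \|\varphi\|_{p,\nu}=\big\||\tau|^\nu\varphi\big\|_{L^p(\mathcal G_{n,k})}.$$ The $k$-plane transform of a function $f$ on $\mathbb R^n$ is $$(R_kf)(\xi,u)=\int_\xi f(y+u)\,dy ,$$ where $dy$ is Lebesgue measure on $\xi$. Write $\sigma_{d-1}=2\pi^{d/2}/\Gamma(d/2)$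 for the area of the unit sphere in $\mathbb R^d$. **Theorem.** Let $1\le p\le\infty$, $1/p+1/p'=1$, $\nu=\mu-k/p'$ and $\mu>k-n/p$. Then for every $f\in L^p_\mu(\mathbb R^n)$ the integral $(R_kf)(\tau)$ converges absolutely for almost all $\tau\in\mathcal G_{n,k}$, and $R_k$ is a bounded linear operator from $L^p_\mu(\mathbb R^n)$ to $L^p_\nu(\mathcal G_{n,k})$ with operator norm $$\|R_k\|=\pi^{k/2}\left(\frac{\sigma_{n-k-1}}{\sigma_{n-1}}\right)^{1/p}\frac{\Gamma\big((\mu+n/p-k)/2\big)}{\Gamma\big((\mu+n/p)/2\big)} .$$ (Here $1/\infty=0$.) -/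

import Mathlib

open MeasureTheory Module
open scoped ENNReal

noncomputable section

/-! ### Weighted Lebesgue spaces -/

/-- The space of (almost everywhere classes of) functions `f` such that `w • f` lies in `L^p`. -/
def weightedLp {X : Type*} [MeasurableSpace X] (𝕜 : Type*) [RCLike 𝕜] (w : X → ℝ) (p : ℝ≥0∞)
    (m : Measure X) : Submodule 𝕜 (X →ₘ[m] 𝕜) where
  carrier := {f | MemLp (fun x => w x • f x) p m}
  zero_mem' := by
    refine (MemLp.zero (ε := 𝕜)).ae_eq ?_
    filter_upwards [AEEqFun.coeFn_zero (β := 𝕜) (μ := m)] with x hx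
    simp [hx]
  add_mem' := by
    intro f g hf hg
    refine (MemLp.add hf hg).ae_eq ?_
    filter_upwards [AEEqFun.coeFn_add f g] with x hx
    simp [hx]
  smul_mem' := by
    intro c f hf
    refine (MemLp.const_smul hf c).ae_eq ?_
    filter_upwards [AEEqFun.coeFn_smul c f] with x hx
    simp [hx, mul_left_comm, RCLike.real_smul_eq_coe_mul]

theorem weightedLp.memLp {X : Type*} [MeasurableSpace X] {𝕜 : Type*} [RCLike 𝕜] {w : X → ℝ}
    {p : ℝ≥0∞} {m : Measure X} (f : weightedLp 𝕜 w p m) :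
    MemLp (fun x => w x • (f : X →ₘ[m] 𝕜) x) p m :=
  f.2

/-- Multiplication by the weight, as a linear map from the weighted space to `L^p`. -/
def weightedLp.toLp {X : Type*} [MeasurableSpace X] (𝕜 : Type*) [RCLike 𝕜] (w : X → ℝ) (p : ℝ≥0∞)
    (m : Measure X) : weightedLp 𝕜 w p m →ₗ[𝕜] Lp 𝕜 p m where
  toFun f := MemLp.toLp (fun x => w x • (f : X →ₘ[m] 𝕜) x) (weightedLp.memLp f)
  map_add' f g := by
    rw [← MemLp.toLp_add]
    refine (MemLp.toLp_eq_toLp_iff _ _).2 ?_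
    filter_upwards [AEEqFun.coeFn_add (f : X →ₘ[m] 𝕜) (g : X →ₘ[m] 𝕜)] with x hx
    simp [hx]
  map_smul' c f := by
    rw [RingHom.id_apply, ← MemLp.toLp_const_smul]
    refine (MemLp.toLp_eq_toLp_iff _ _).2 ?_
    filter_upwards [AEEqFun.coeFn_smul c (f : X →ₘ[m] 𝕜)] with x hx
    simp [hx, mul_left_comm, RCLike.real_smul_eq_coe_mul]

/-- The norm of `f` in the weighted space is the `L^p` norm of `w • f`. -/
instance weightedLp.instSeminormedAddCommGroup {X : Type*} [MeasurableSpace X] {𝕜 : Type*}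
    [RCLike 𝕜] {w : X → ℝ} {p : ℝ≥0∞} [Fact (1 ≤ p)] {m : Measure X} :
    SeminormedAddCommGroup (weightedLp 𝕜 w p m) :=
  SeminormedAddCommGroup.induced _ (Lp 𝕜 p m) (weightedLp.toLp 𝕜 w p m)

instance weightedLp.instNormedSpace {X : Type*} [MeasurableSpace X] {𝕜 : Type*}
    [RCLike 𝕜] {w : X → ℝ} {p : ℝ≥0∞} [Fact (1 ≤ p)] {m : Measure X} :
    NormedSpace 𝕜 (weightedLp 𝕜 w p m) :=
  NormedSpace.induced 𝕜 _ (Lp 𝕜 p m) (weightedLp.toLp 𝕜 w p m)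

/-! ### The orthogonal group -/

/-- The orthogonal group `O(n)`: the linear maps `g` of `ℝⁿ` with `g* g = g g* = 1`. -/
abbrev OrthGroup (n : ℕ) : Type :=
  unitary (EuclideanSpace ℝ (Fin n) →L[ℝ] EuclideanSpace ℝ (Fin n))

instance OrthGroup.instContinuousStar (n : ℕ) :
    ContinuousStar (EuclideanSpace ℝ (Fin n) →L[ℝ] EuclideanSpace ℝ (Fin n)) :=
  ⟨(ContinuousLinearMap.adjoint (𝕜 := ℝ) (E := EuclideanSpace ℝ (Fin n))
    (F := EuclideanSpace ℝ (Fin n))).continuous⟩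

instance OrthGroup.instCompactSpace (n : ℕ) : CompactSpace (OrthGroup n) := by
  have : ProperSpace (EuclideanSpace ℝ (Fin n) →L[ℝ] EuclideanSpace ℝ (Fin n)) :=
    FiniteDimensional.proper ℝ _
  refine isCompact_iff_compactSpace.1 (Metric.isCompact_of_isClosed_isBounded isClosed_unitary ?_)
  refine (Metric.isBounded_closedBall (x := 0) (r := 1)).subset fun u hu => ?_
  rw [mem_closedBall_zero_iff]
  refine ContinuousLinearMap.opNorm_le_bound _ zero_le_one fun x => ?_
  rw [one_mul]
  exact (ContinuousLinearMap.norm_map_of_mem_unitary hu x).le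

instance OrthGroup.instBorelSpace (n : ℕ) : BorelSpace (OrthGroup n) :=
  Subtype.borelSpace _

/-- The invariant probability measure on `O(n)`. -/
def orthHaar (n : ℕ) : Measure (OrthGroup n) :=
  Measure.haarMeasure ⊤

instance orthHaar.instIsProbabilityMeasure (n : ℕ) : IsProbabilityMeasure (orthHaar n) :=
  ⟨by
    rw [orthHaar]
    exact Measure.haarMeasure_self (K₀ := (⊤ : TopologicalSpace.PositiveCompacts (OrthGroup n)))⟩

/-! ### The Grassmann manifold -/

/-- The `k`-dimensional linear subspaces of `ℝⁿ`. -/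
abbrev Grass (n k : ℕ) : Type :=
  {ξ : Submodule ℝ (EuclideanSpace ℝ (Fin n)) // finrank ℝ ξ = k}

/-- The topology of the Grassmann manifold, through `ξ ↦` (orthogonal projection onto `ξ`). -/
instance Grass.instTopologicalSpace (n k : ℕ) : TopologicalSpace (Grass n k) :=
  TopologicalSpace.induced (fun ξ => ξ.1.starProjection) inferInstance

instance Grass.instMeasurableSpace (n k : ℕ) : MeasurableSpace (Grass n k) :=
  borel _

instance Grass.instBorelSpace (n k : ℕ) : BorelSpace (Grass n k) :=
  ⟨rfl⟩

theorem OrthGroup.inner_map {n : ℕ} (g : OrthGroup n) (x y : EuclideanSpace ℝ (Fin n)) :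
    inner ℝ (g.1 x) (g.1 y) = inner ℝ x y :=
  ContinuousLinearMap.inner_map_map_of_mem_unitary g.2 x y

theorem OrthGroup.apply_star {n : ℕ} (g : OrthGroup n) (x : EuclideanSpace ℝ (Fin n)) :
    g.1 ((star g.1 : EuclideanSpace ℝ (Fin n) →L[ℝ] EuclideanSpace ℝ (Fin n)) x) = x :=
  congrArg (fun T : EuclideanSpace ℝ (Fin n) →L[ℝ] EuclideanSpace ℝ (Fin n) => T x)
    (Unitary.mul_star_self_of_mem g.2)

theorem OrthGroup.injective {n : ℕ} (g : OrthGroup n) : Function.Injective g.1 := by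
  intro x y h
  have e (z : EuclideanSpace ℝ (Fin n)) : (star g).1 (g.1 z) = z :=
    congrArg (fun T : EuclideanSpace ℝ (Fin n) →L[ℝ] EuclideanSpace ℝ (Fin n) => T z)
      (Unitary.star_mul_self_of_mem g.2)
  rw [← e x, ← e y, h]

/-- The rotated subspace `g ξ`. -/
def Grass.rotate {n k : ℕ} (g : OrthGroup n) (ξ : Grass n k) : Grass n k :=
  ⟨ξ.1.map (g.1 : EuclideanSpace ℝ (Fin n) →ₗ[ℝ] EuclideanSpace ℝ (Fin n)),
    (LinearEquiv.finrank_eq (Submodule.equivMapOfInjective _ g.injective ξ.1)).symm.trans ξ.2⟩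

/-- The coordinate subspace `ℝᵏ = ℝ e₁ ⊕ ⋯ ⊕ ℝ e_k` of `ℝⁿ`. -/
def Grass.coord {n k : ℕ} (h : k ≤ n) : Grass n k :=
  ⟨Submodule.span ℝ (Set.range fun i : Fin k => EuclideanSpace.single (Fin.castLE h i) (1 : ℝ)), by
    have := (EuclideanSpace.basisFun (Fin n) ℝ).orthonormal.linearIndependent.comp
      (Fin.castLE h) (Fin.castLE_injective h)
    rw [finrank_span_eq_card, Fintype.card_fin]
    simpa [Function.comp_def] using this⟩

theorem Grass.starProjection_rotate {n k : ℕ} (g : OrthGroup n) (ξ : Grass n k) :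
    (Grass.rotate g ξ).1.starProjection = g.1 * ξ.1.starProjection * star g.1 := by
  refine ContinuousLinearMap.ext fun v => ?_
  refine ((Grass.rotate g ξ).1.eq_starProjection_of_mem_of_inner_eq_zero
    (u := v) (v := (g.1 * ξ.1.starProjection * star g.1) v) ?_ ?_)
  · exact ⟨ξ.1.starProjection ((star g.1 :
      EuclideanSpace ℝ (Fin n) →L[ℝ] EuclideanSpace ℝ (Fin n)) v),
      Submodule.starProjection_apply_mem _ _, rfl⟩
  · rintro _ ⟨y, hy, rfl⟩
    have h := ξ.1.starProjection_inner_eq_zero ((star g.1 :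
      EuclideanSpace ℝ (Fin n) →L[ℝ] EuclideanSpace ℝ (Fin n)) v) y hy
    rw [← g.inner_map, map_sub, g.apply_star] at h
    exact h

theorem Grass.continuous_rotate {n k : ℕ} (ξ : Grass n k) :
    Continuous fun g : OrthGroup n => Grass.rotate g ξ := by
  refine continuous_induced_rng.2 ?_
  simp only [Function.comp_def, Grass.starProjection_rotate]
  fun_prop

theorem Grass.continuous_starProjection {n k : ℕ} :
    Continuous fun ξ : Grass n k => ξ.1.starProjection :=
  continuous_induced_dom

/-- The `O(n)`-invariant probability measure `dξ` on the Grassmann manifold: the image of the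
invariant probability measure of `O(n)` under `g ↦ g ℝᵏ`. -/
def grassMeasure {n k : ℕ} (h : k ≤ n) : Measure (Grass n k) :=
  (orthHaar n).map fun g => Grass.rotate g (Grass.coord h)

instance grassMeasure.instIsProbabilityMeasure {n k : ℕ} (h : k ≤ n) :
    IsProbabilityMeasure (grassMeasure h) :=
  Measure.isProbabilityMeasure_map (Grass.continuous_rotate _).measurable.aemeasurable

theorem grassMeasure_map_rotate {n k : ℕ} (h : k ≤ n) (g : OrthGroup n) :
    (grassMeasure h).map (Grass.rotate g) = grassMeasure h := by
  have hg : Continuous (Grass.rotate g : Grass n k → Grass n k) := by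
    refine continuous_induced_rng.2 ?_
    simp only [Function.comp_def, Grass.starProjection_rotate]
    exact (continuous_const.mul continuous_induced_dom).mul continuous_const
  have hG : Measurable fun a : OrthGroup n => Grass.rotate a (Grass.coord h) :=
    (Grass.continuous_rotate _).measurable
  have hi : (orthHaar n).map (g * ·) = orthHaar n :=
    map_mul_left_eq_self (Measure.haarMeasure ⊤) g
  rw [grassMeasure, Measure.map_map hg.measurable hG]
  conv_rhs => rw [← hi, Measure.map_map hG (continuous_const_mul g).measurable]
  congr 1
  funext a
  refine Subtype.ext ?_
  exact (Submodule.map_comp _ _ _).symm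

/-! ### The manifold of affine planes -/

/-- The `k`-planes of `ℝⁿ`: the plane `τ = ξ + u` is represented by the pair `(ξ, u)` of its
direction `ξ` and of `u ∈ ξᗮ`. -/
abbrev AffGrass (n k : ℕ) : Type :=
  {τ : Grass n k × EuclideanSpace ℝ (Fin n) // τ.2 ∈ τ.1.1ᗮ}

/-- The plane `ξ + u` as an affine subspace of `ℝⁿ`. -/
def AffGrass.plane {n k : ℕ} (τ : AffGrass n k) : AffineSubspace ℝ (EuclideanSpace ℝ (Fin n)) :=
  AffineSubspace.mk' τ.1.2 τ.1.1.1

/-- `|τ|`: the Euclidean distance from the plane `τ` to the origin. -/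
def AffGrass.dist {n k : ℕ} (τ : AffGrass n k) : ℝ :=
  Metric.infDist 0 (τ.plane : Set (EuclideanSpace ℝ (Fin n)))

theorem AffGrass.dist_eq {n k : ℕ} (τ : AffGrass n k) : τ.dist = ‖τ.1.2‖ := by
  have hmem : τ.1.2 ∈ (τ.plane : Set (EuclideanSpace ℝ (Fin n))) :=
    AffineSubspace.self_mem_mk' _ _
  refine le_antisymm ?_ ?_
  · have h := Metric.infDist_le_dist_of_mem (x := 0) hmem
    rwa [dist_zero_left] at h
  · refine (Metric.le_infDist ⟨_, hmem⟩).2 fun y hy => ?_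
    have hy' : y - τ.1.2 ∈ τ.1.1.1 := AffineSubspace.mem_mk'.1 hy
    have h0 : inner ℝ (y - τ.1.2) τ.1.2 = 0 := τ.2 _ hy'
    have h1 := norm_add_sq_eq_norm_sq_add_norm_sq_of_inner_eq_zero _ _ h0
    rw [sub_add_cancel] at h1
    rw [dist_zero_left]
    nlinarith [norm_nonneg y, norm_nonneg τ.1.2, mul_self_nonneg ‖y - τ.1.2‖]

/-- The fibre measure `du` on `ξᗮ`, seen on the manifold of `k`-planes. -/
def AffGrass.fibre {n k : ℕ} (ξ : Grass n k) : Measure (AffGrass n k) :=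
  (volume : Measure ξ.1ᗮ).map fun u => ⟨(ξ, u.1), u.2⟩

theorem AffGrass.measurable_fibre {n k : ℕ} :
    Measurable (AffGrass.fibre : Grass n k → Measure (AffGrass n k)) := by
  refine Measure.measurable_of_measurable_coe _ fun s hs => ?_
  -- `c` is the volume of the unit ball of any `k`-dimensional subspace
  set c : ℝ≥0∞ := volume (Metric.ball (0 : EuclideanSpace ℝ (Fin k)) 1) with hc
  have hc0 : c ≠ 0 := (Metric.measure_ball_pos _ _ one_pos).ne'
  have hct : c ≠ ⊤ := measure_ball_lt_top.ne
  have hP : Continuous fun q : Grass n k × EuclideanSpace ℝ (Fin n) =>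
      q.1.1.starProjection q.2 :=
    (Grass.continuous_starProjection.comp continuous_fst).clm_apply continuous_snd
  let φ : Grass n k × EuclideanSpace ℝ (Fin n) → AffGrass n k := fun q =>
    ⟨(q.1, q.2 - q.1.1.starProjection q.2), q.1.1.sub_starProjection_mem_orthogonal q.2⟩
  have hφ : Measurable φ :=
    (measurable_fst.prodMk (measurable_snd.sub hP.measurable)).subtype_mk
  let S : Set (Grass n k × EuclideanSpace ℝ (Fin n)) :=
    {q | ‖q.1.1.starProjection q.2‖ < 1} ∩ φ ⁻¹' s
  have hS : MeasurableSet S :=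
    (hP.norm.measurable measurableSet_Iio).inter (hφ hs)
  have key : ∀ ξ : Grass n k, AffGrass.fibre ξ s = c⁻¹ * volume (Prod.mk ξ ⁻¹' S) := by
    intro ξ
    have hm : Measurable fun u : ξ.1ᗮ => (⟨(ξ, u.1), u.2⟩ : AffGrass n k) :=
      (measurable_const.prodMk measurable_subtype_coe).subtype_mk
    have hball : volume (Metric.ball (0 : ξ.1) 1) = c := by
      let e : ξ.1 ≃ₗᵢ[ℝ] EuclideanSpace ℝ (Fin k) :=
        ((stdOrthonormalBasis ℝ ξ.1).reindex (finCongr ξ.2)).repr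
      rw [hc, ← e.measurePreserving.measure_preimage measurableSet_ball.nullMeasurableSet]
      simp
    have hmp : MeasurePreserving (fun x => WithLp.ofLp (ξ.1.orthogonalDecomposition x))
        volume volume :=
      (WithLp.volume_preserving_ofLp _ _).comp ξ.1.orthogonalDecomposition.measurePreserving
    have hset : Prod.mk ξ ⁻¹' S = (fun x => WithLp.ofLp (ξ.1.orthogonalDecomposition x)) ⁻¹'
        (Metric.ball (0 : ξ.1) 1 ×ˢ ((fun u : ξ.1ᗮ => (⟨(ξ, u.1), u.2⟩ : AffGrass n k)) ⁻¹' s)) := by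
      ext x
      simp [S, φ, Submodule.orthogonalDecomposition_apply,
        Submodule.orthogonalProjectionOnto_orthogonal]
    rw [hset, hmp.measure_preimage (measurableSet_ball.prod (hm hs)).nullMeasurableSet,
      Measure.volume_eq_prod, Measure.prod_prod, hball, ← mul_assoc,
      ENNReal.inv_mul_cancel hc0 hct, one_mul, AffGrass.fibre, Measure.map_apply hm hs]
  simp only [key]
  exact (measurable_measure_prodMk_left hS).const_mul _

/-- The measure `dτ = dξ du` on the manifold of `k`-planes. -/
def affGrassMeasure {n k : ℕ} (h : k ≤ n) : Measure (AffGrass n k) :=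
  (grassMeasure h).bind AffGrass.fibre

theorem lintegral_affGrassMeasure {n k : ℕ} (h : k ≤ n) {F : AffGrass n k → ℝ≥0∞}
    (hF : Measurable F) :
    ∫⁻ τ, F τ ∂affGrassMeasure h =
      ∫⁻ ξ, (∫⁻ u : ξ.1ᗮ, F ⟨(ξ, u.1), u.2⟩) ∂grassMeasure h := by
  rw [affGrassMeasure, Measure.lintegral_bind AffGrass.measurable_fibre.aemeasurable
    hF.aemeasurable]
  refine lintegral_congr fun ξ => ?_
  rw [AffGrass.fibre, lintegral_map hF (by fun_prop)]

/-! ### The `k`-plane transform -/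

/-- The `k`-plane transform `(R_k f)(ξ, u) = ∫_ξ f(y + u) dy`. -/
def kPlaneTransform {n k : ℕ} {𝕜 : Type*} [RCLike 𝕜] (f : EuclideanSpace ℝ (Fin n) → 𝕜)
    (τ : AffGrass n k) : 𝕜 :=
  ∫ y : τ.1.1.1, f (y.1 + τ.1.2)

/-- `σ_{d-1} = 2 π^{d/2} / Γ(d/2)`, the area of the unit sphere `S^{d-1}` of `ℝᵈ`, as a function
of `d`. -/
def sphereArea (d : ℕ) : ℝ :=
  2 * Real.pi ^ ((d : ℝ) / 2) / Real.Gamma ((d : ℝ) / 2)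

end

/-! A plane is written as `g (ℝᵏ + v)` with `g` in `O(n)` and `v ⊥ ℝᵏ`, and the point of `ℝᵏ` is
rescaled to `|v| y`. For `v ≠ 0` this gives `R_k f = |v|^k ∫ f (g (|v| y + v)) dy`, and the argument
of `f` has norm `s |v|` with `s = √(1 + |y|²)`, whatever `g` is. The relation `ν + k = μ + k/p`
splits the total power of `|v|` into `|v|^μ`, which becomes the weight of `f`, and `|v|^{k/p}`,
which turns `dg dv` into `|v|^k dg dv`.

For fixed `y`, the map `(g, v) ↦ g (|v| y + v)` carries `|v|^k dg dv` to `(σ_{n-k-1}/σ_{n-1})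
s^{-n}` times Lebesgue measure (`AffGrass.map_point`). So the integrand at `y` has `L^p` norm
exactly `s^{-(μ+n/p)} (σ_{n-k-1}/σ_{n-1})^{1/p} ‖f‖_{p,μ}` for `f ≥ 0` (`eLpNorm_point`).
Minkowski's inequality (`eLpNorm_lintegral_le`) bounds the norm of `R_k f` by the integral over `y`.
The integral of `(1 + |y|²)^{-(μ+n/p)/2}` over `ℝᵏ` is the Gamma quotient
(`lintegral_one_add_norm_sq_rpow`), finite because `μ + n/p > k`.

The bound is sharp because Minkowski is nearly an equality on nearly homogeneous functions. The
tails `|x|^{-r} 1_{|x|>1}` with `r > μ + n/p` lie in the space and decrease by at most `s^{-r}`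
under dilation by `s ≥ 1`. This yields the same constant with `r` in place of `μ + n/p` as a lower
bound (`le_eLpNorm_kPlane`), and `r ↓ μ + n/p` concludes. The exponent `1/p` is `(p⁻¹).toReal`
throughout, so that `p = ∞` fits the same formulas. -/

section Radial

/-! ### Radial integrals and the Gamma quotient. -/

theorem lintegral_fun_norm_addHaar {E : Type*} [NormedAddCommGroup E] [NormedSpace ℝ E]
    [FiniteDimensional ℝ E] [MeasurableSpace E] [BorelSpace E] [Nontrivial E] (m : Measure E)
    [m.IsAddHaarMeasure] {f : ℝ → ℝ≥0∞} (hf : Measurable f) :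
    ∫⁻ x, f ‖x‖ ∂m = finrank ℝ E * m (Metric.ball 0 1) *
      ∫⁻ r in Set.Ioi (0 : ℝ), ENNReal.ofReal (r ^ (finrank ℝ E - 1)) * f r := by
  calc
    ∫⁻ x, f ‖x‖ ∂m = ∫⁻ x : ({(0)}ᶜ : Set E), f ‖x.1‖ ∂(m.comap (↑)) := by
      rw [lintegral_subtype_comap (measurableSet_singleton _).compl fun x => f ‖x‖,
        MeasureTheory.restrict_compl_singleton]
    _ = ∫⁻ x, f x.2 ∂m.toSphere.prod (.volumeIoiPow (finrank ℝ E - 1)) := by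
      rw [← m.measurePreserving_homeomorphUnitSphereProd.lintegral_comp_emb
        (Homeomorph.measurableEmbedding _)]
      simp
    _ = m.toSphere Set.univ * ∫⁻ r : Set.Ioi (0 : ℝ), f r ∂.volumeIoiPow (finrank ℝ E - 1) := by
      rw [lintegral_prod _ (by fun_prop)]
      simp [mul_comm]
    _ = _ := by
      rw [m.toSphere_apply_univ, Measure.volumeIoiPow,
        lintegral_withDensity_eq_lintegral_mul _ (by fun_prop) (by fun_prop)]
      congr 1
      exact lintegral_subtype_comap measurableSet_Ioi
        fun r => ENNReal.ofReal (r ^ (finrank ℝ E - 1)) * f r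

theorem sphereArea_pos {d : ℕ} (hd : 0 < d) : 0 < sphereArea d := by
  have := Real.Gamma_pos_of_pos (show (0 : ℝ) < (d : ℝ) / 2 by positivity)
  unfold sphereArea
  positivity

variable {E : Type*} [NormedAddCommGroup E] [InnerProductSpace ℝ E] [FiniteDimensional ℝ E]
  [MeasurableSpace E] [BorelSpace E]

theorem finrank_mul_volume_ball [Nontrivial E] :
    (finrank ℝ E : ℝ≥0∞) * volume (Metric.ball (0 : E) 1) =
      ENNReal.ofReal (sphereArea (finrank ℝ E)) := by
  have hd : (0 : ℝ) < finrank ℝ E := by exact_mod_cast finrank_pos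
  have hG := Real.Gamma_pos_of_pos (half_pos hd)
  rw [InnerProductSpace.volume_ball, ENNReal.ofReal_one, one_pow, one_mul,
    ← ENNReal.ofReal_natCast, ← ENNReal.ofReal_mul (Nat.cast_nonneg _), sphereArea,
    Real.Gamma_add_one (half_pos hd).ne', Real.sqrt_eq_rpow, ← Real.rpow_natCast,
    ← Real.rpow_mul Real.pi_pos.le]
  congr 1
  rw [show (1 / 2 : ℝ) * (finrank ℝ E : ℝ) = finrank ℝ E / 2 by ring]
  field_simp

/-- Comparison of the integrals of a radial function over spaces of different dimensions. -/
theorem lintegral_norm_pow_mul_fun_norm {F : Type*} [NormedAddCommGroup F] [InnerProductSpace ℝ F]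
    [FiniteDimensional ℝ F] [MeasurableSpace F] [BorelSpace F] [Nontrivial E] [Nontrivial F]
    {k : ℕ} (hk : finrank ℝ F + k = finrank ℝ E) {f : ℝ → ℝ≥0∞} (hf : Measurable f) :
    ∫⁻ v : F, ‖v‖ₑ ^ k * f ‖v‖ =
      ENNReal.ofReal (sphereArea (finrank ℝ F) / sphereArea (finrank ℝ E)) *
        ∫⁻ x : E, f ‖x‖ := by
  have hF : 0 < finrank ℝ F := finrank_pos
  have hE : 0 < finrank ℝ E := finrank_pos
  have h1 := lintegral_fun_norm_addHaar (volume : Measure F)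
    (f := fun r => ENNReal.ofReal (r ^ k) * f r) (by fun_prop)
  have h2 (v : F) : ENNReal.ofReal (‖v‖ ^ k) = ‖v‖ₑ ^ k := by
    rw [ENNReal.ofReal_pow (norm_nonneg _), ofReal_norm]
  simp only [h2] at h1
  rw [h1, lintegral_fun_norm_addHaar (volume : Measure E) hf, finrank_mul_volume_ball,
    finrank_mul_volume_ball, ← mul_assoc, ← ENNReal.ofReal_mul
      (div_nonneg (sphereArea_pos hF).le (sphereArea_pos hE).le),
    div_mul_cancel₀ _ (sphereArea_pos hE).ne']
  congr 1
  refine setLIntegral_congr_fun measurableSet_Ioi fun r hr => ?_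
  have hr' : (0 : ℝ) ≤ r := le_of_lt hr
  -- The factor `r^k` raises the polar density of `F` to that of `E`. Both dimensions are positive,
  -- so the truncated subtractions of 1 are genuine.
  rw [← mul_assoc, ← ENNReal.ofReal_mul (by positivity), ← pow_add]
  congr 4
  omega

theorem lintegral_comp_pos_smul {s : ℝ} (hs : 0 < s) {f : E → ℝ≥0∞} (hf : Measurable f) :
    ∫⁻ x, f (s • x) = (ENNReal.ofReal s ^ finrank ℝ E)⁻¹ * ∫⁻ x, f x := by
  have h := congrArg (fun m => ∫⁻ x, f x ∂m)
    (Measure.map_addHaar_smul (volume : Measure E) hs.ne')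
  rw [lintegral_map hf (by fun_prop), lintegral_smul_measure, smul_eq_mul] at h
  rw [h, abs_of_pos (by positivity), ENNReal.ofReal_inv_of_pos (by positivity),
    ENNReal.ofReal_pow hs.le]

/-- The integral of `(1 + ‖x‖²)^{-t/2}`, through the Gaussian integral. -/
theorem lintegral_one_add_norm_sq_rpow {t : ℝ} (ht : (finrank ℝ E : ℝ) < t) :
    ∫⁻ x : E, ENNReal.ofReal ((1 + ‖x‖ ^ 2) ^ (-t / 2)) =
      ENNReal.ofReal (Real.pi ^ ((finrank ℝ E : ℝ) / 2) *
        (Real.Gamma ((t - finrank ℝ E) / 2) / Real.Gamma (t / 2))) := by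
  set d : ℝ := ((finrank ℝ E : ℕ) : ℝ)
  have hd0 : 0 ≤ d := Nat.cast_nonneg _
  have ht0 : 0 < t / 2 := by linarith
  have hGt := Real.Gamma_pos_of_pos ht0
  have hGd := Real.Gamma_pos_of_pos (show 0 < (t - d) / 2 by linarith)
  have gam {a b : ℝ} (ha : 0 < a) (hb : 0 < b) :
      ∫⁻ r in Set.Ioi (0 : ℝ), ENNReal.ofReal (r ^ (a - 1) * Real.exp (-(b * r))) =
        ENNReal.ofReal ((1 / b) ^ a * Real.Gamma a) := by
    rw [← Real.integral_rpow_mul_exp_neg_mul_Ioi ha hb,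
      ofReal_integral_eq_lintegral_ofReal]
    · have := Real.integral_rpow_mul_exp_neg_mul_Ioi ha hb
      -- Integrability follows from the known value: a non-integrable function has Bochner integral
      -- 0, but the value is positive.
      refine Classical.not_not.1 fun h => ?_
      rw [integral_undef h] at this
      have := Real.Gamma_pos_of_pos ha
      have : 0 < (1 / b) ^ a * Real.Gamma a := by positivity
      linarith
    · filter_upwards [ae_restrict_mem measurableSet_Ioi] with r hr
      have : (0 : ℝ) < r := hr
      positivity
  have gau {r : ℝ} (hr : 0 < r) :
      ∫⁻ x : E, ENNReal.ofReal (Real.exp (-r * ‖x‖ ^ 2)) =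
        ENNReal.ofReal ((Real.pi / r) ^ (d / 2)) := by
    rw [← GaussianFourier.integral_rexp_neg_mul_sq_norm (V := E) hr,
      ofReal_integral_eq_lintegral_ofReal]
    · refine Classical.not_not.1 fun h => ?_
      have := GaussianFourier.integral_rexp_neg_mul_sq_norm (V := E) hr
      rw [integral_undef h] at this
      have h2 : 0 < (Real.pi / r) ^ (d / 2) := Real.rpow_pos_of_pos (div_pos Real.pi_pos hr) _
      linarith
    · exact Filter.Eventually.of_forall fun x => (Real.exp_pos _).le
  -- `Γ(t/2) (1+|x|²)^{-t/2}` is the integral of `r^{t/2-1} exp(-(1+|x|²) r)` over `r > 0`. After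
  -- Tonelli the Gaussian in `x` contributes `(π/r)^{d/2}`, and another Gamma integral remains.
  have key : ENNReal.ofReal (Real.Gamma (t / 2)) *
      ∫⁻ x : E, ENNReal.ofReal ((1 + ‖x‖ ^ 2) ^ (-t / 2)) =
      ENNReal.ofReal (Real.pi ^ (d / 2) * Real.Gamma ((t - d) / 2)) := by
    calc
      _ = ∫⁻ x : E, ∫⁻ r in Set.Ioi (0 : ℝ),
          ENNReal.ofReal (r ^ (t / 2 - 1) * Real.exp (-((1 + ‖x‖ ^ 2) * r))) := by
        rw [← lintegral_const_mul _ (by fun_prop)]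
        refine lintegral_congr fun x => ?_
        rw [gam ht0 (by positivity), ← ENNReal.ofReal_mul hGt.le, mul_comm, one_div,
          Real.inv_rpow (by positivity), ← Real.rpow_neg (by positivity), neg_div]
      _ = ∫⁻ r in Set.Ioi (0 : ℝ), ∫⁻ x : E,
          ENNReal.ofReal (r ^ (t / 2 - 1) * Real.exp (-((1 + ‖x‖ ^ 2) * r))) :=
        lintegral_lintegral_swap (by fun_prop)
      _ = ∫⁻ r in Set.Ioi (0 : ℝ), ENNReal.ofReal (Real.pi ^ (d / 2)) *
          ENNReal.ofReal (r ^ ((t - d) / 2 - 1) * Real.exp (-(1 * r))) := by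
        refine setLIntegral_congr_fun measurableSet_Ioi fun r hr => ?_
        have hr' : (0 : ℝ) < r := hr
        have e (x : E) : ENNReal.ofReal (r ^ (t / 2 - 1) * Real.exp (-((1 + ‖x‖ ^ 2) * r))) =
            ENNReal.ofReal (r ^ (t / 2 - 1) * Real.exp (-r)) *
              ENNReal.ofReal (Real.exp (-r * ‖x‖ ^ 2)) := by
          rw [← ENNReal.ofReal_mul (by positivity), mul_assoc, ← Real.exp_add]
          ring_nf
        simp only [e]
        rw [lintegral_const_mul _ (by fun_prop), gau hr', ← ENNReal.ofReal_mul (by positivity),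
          ← ENNReal.ofReal_mul (by positivity), Real.div_rpow Real.pi_pos.le hr'.le,
          show (t - d) / 2 - 1 = (t / 2 - 1) - d / 2 by ring, Real.rpow_sub hr' _ (d / 2), one_mul]
        congr 1
        ring
      _ = _ := by
        rw [lintegral_const_mul _ (by fun_prop), gam (by linarith) one_pos,
          ← ENNReal.ofReal_mul (by positivity)]
        simp
  rw [← mul_div_assoc, ENNReal.ofReal_div_of_pos hGt, ← key, mul_comm, ENNReal.mul_div_cancel_right]
  · simpa using hGt
  · simp

end Radial

/-! ### Minkowski's inequality and changes of density. -/

section Minkowski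

/-- An integral Minkowski inequality for a family whose norms are bounded by a weight. -/
theorem eLpNorm_lintegral_le {X Y : Type*} [MeasurableSpace X] [MeasurableSpace Y]
    {m : Measure X} {m' : Measure Y} [SFinite m] [SFinite m'] {F : X → Y → ℝ≥0∞}
    (hF : Measurable (Function.uncurry F)) {w : Y → ℝ≥0∞} (hw : Measurable w)
    (hw0 : ∀ y, w y ≠ 0) (hwt : ∀ y, w y ≠ ⊤) {p : ℝ≥0∞} (hp : 1 ≤ p) {A : ℝ≥0∞}
    (h : ∀ y, eLpNorm (fun x => F x y) p m ≤ w y * A) :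
    eLpNorm (fun x => ∫⁻ y, F x y ∂m') p m ≤ (∫⁻ y, w y ∂m') * A := by
  have hp0 : p ≠ 0 := (zero_lt_one.trans_le hp).ne'
  have hFx (x : X) : Measurable (F x) := hF.comp measurable_prodMk_left
  rcases eq_or_ne p ⊤ with rfl | hpt
  · rw [eLpNorm_exponent_top]
    have h1 : ∀ y, ∀ᵐ x ∂m, F x y ≤ w y * A := fun y => by
      filter_upwards [ae_le_eLpNormEssSup (f := fun x => F x y) (μ := m)] with x hx
      exact (hx.trans (by simpa using h y))
    -- The null set of `x` depends on `y`, and Tonelli for null sets exchanges the two quantifiers.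
    have h2 : ∀ᵐ x ∂m, ∀ᵐ y ∂m', F x y ≤ w y * A :=
      (Measure.ae_ae_comm (p := fun x y => F x y ≤ w y * A) (measurableSet_le hF
        ((hw.comp measurable_snd).mul_const A))).2 (Filter.Eventually.of_forall h1)
    refine eLpNormEssSup_le_of_ae_enorm_bound ?_
    filter_upwards [h2] with x hx
    rw [enorm_eq_self, ← lintegral_mul_const _ hw]
    exact lintegral_mono_ae hx
  · set q := p.toReal
    have hq1 : 1 ≤ q := by
      rw [← ENNReal.toReal_one]
      exact ENNReal.toReal_mono hpt hp
    have hq0 : 0 < q := by linarith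
    rw [eLpNorm_eq_lintegral_rpow_enorm_toReal hp0 hpt]
    simp only [enorm_eq_self]
    have hy (y : Y) : ∫⁻ x, F x y ^ q ∂m ≤ w y ^ q * A ^ q := by
      have := h y
      rw [eLpNorm_eq_lintegral_rpow_enorm_toReal hp0 hpt, one_div,
        ENNReal.rpow_inv_le_iff hq0, ENNReal.mul_rpow_of_nonneg _ _ hq0.le] at this
      simpa using this
    -- Jensen's inequality for the measure `w dy`, obtained from Hölder with `F = (F w^{-1/q'})
    -- w^{1/q'}`.
    have hJ (x : X) : (∫⁻ y, F x y ∂m') ^ q ≤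
        (∫⁻ y, w y ∂m') ^ (q - 1) * ∫⁻ y, F x y ^ q * w y ^ (1 - q) ∂m' := by
      rcases hq1.eq_or_lt with hq | hq
      · simp [← hq]
      · have hc : q.HolderConjugate (q.conjExponent) := .conjExponent hq
        have hq' := hc.symm.pos
        have hh := ENNReal.lintegral_mul_le_Lp_mul_Lq m' hc
          (f := fun y => F x y * w y ^ (-(1 / q.conjExponent)))
          (g := fun y => w y ^ (1 / q.conjExponent))
          ((hFx x).mul (hw.pow_const _)).aemeasurable (hw.pow_const _).aemeasurable
        have e1 : ∀ y, ((fun y => F x y * w y ^ (-(1 / q.conjExponent))) *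
            fun y => w y ^ (1 / q.conjExponent)) y = F x y := fun y => by
          simp only [Pi.mul_apply]
          rw [mul_assoc, ← ENNReal.rpow_add _ _ (hw0 y) (hwt y)]
          simp
        have e2 : ∀ y, (F x y * w y ^ (-(1 / q.conjExponent))) ^ q =
            F x y ^ q * w y ^ (1 - q) := fun y => by
          rw [ENNReal.mul_rpow_of_nonneg _ _ hq0.le, ← ENNReal.rpow_mul]
          congr 2
          have := hc.sub_one_mul_conj
          field_simp
          linarith
        have e3 : ∀ y, (w y ^ (1 / q.conjExponent)) ^ q.conjExponent = w y := fun y => by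
          rw [← ENNReal.rpow_mul, one_div, inv_mul_cancel₀ hq'.ne', ENNReal.rpow_one]
        simp only [e1, e2, e3] at hh
        calc
          _ ≤ _ := ENNReal.rpow_le_rpow hh hq0.le
          _ = _ := by
            rw [ENNReal.mul_rpow_of_nonneg _ _ hq0.le, ← ENNReal.rpow_mul, ← ENNReal.rpow_mul,
              one_div, inv_mul_cancel₀ hq0.ne', ENNReal.rpow_one, mul_comm]
            congr 2
            have := hc.sub_one_mul_conj
            field_simp
            linarith
    rw [one_div, ENNReal.rpow_inv_le_iff hq0, ENNReal.mul_rpow_of_nonneg _ _ hq0.le]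
    have hm : Measurable fun z : X × Y => F z.1 z.2 ^ q * w z.2 ^ (1 - q) :=
      (hF.pow_const q).mul ((hw.comp measurable_snd).pow_const _)
    calc
      ∫⁻ x, (∫⁻ y, F x y ∂m') ^ q ∂m
        ≤ ∫⁻ x, (∫⁻ y, w y ∂m') ^ (q - 1) * ∫⁻ y, F x y ^ q * w y ^ (1 - q) ∂m' ∂m :=
          lintegral_mono hJ
      _ = (∫⁻ y, w y ∂m') ^ (q - 1) * ∫⁻ y, ∫⁻ x, F x y ^ q * w y ^ (1 - q) ∂m ∂m' := by
          rw [lintegral_const_mul _ hm.lintegral_prod_right', lintegral_lintegral_swap]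
          exact hm.aemeasurable
      _ ≤ (∫⁻ y, w y ∂m') ^ (q - 1) * ∫⁻ y, w y * A ^ q ∂m' := by
          gcongr with y
          have hFy : Measurable fun x => F x y := hF.comp measurable_prodMk_right
          rw [lintegral_mul_const _ (hFy.pow_const q)]
          calc
            _ ≤ (w y ^ q * A ^ q) * w y ^ (1 - q) := by gcongr; exact hy y
            _ = _ := by
              rw [mul_right_comm, ← ENNReal.rpow_add _ _ (hw0 y) (hwt y)]
              simp
      _ = _ := by
          rw [lintegral_mul_const _ hw, ← mul_assoc]
          congr 1
          conv_lhs => rw [← ENNReal.rpow_one (∫⁻ y, w y ∂m'), ← ENNReal.rpow_mul]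
          rw [← ENNReal.rpow_add_of_nonneg _ _ (by linarith) (by norm_num)]
          simp

/-- For finite `p` the density enters as its `p`-th root. For `p = ∞` only null sets count, and they
are unchanged because the density vanishes almost nowhere. -/
theorem eLpNorm_withDensity {X : Type*} [MeasurableSpace X] {m : Measure X} {d : X → ℝ≥0∞}
    (hd : Measurable d) (hd0 : ∀ᵐ x ∂m, d x ≠ 0) {p : ℝ≥0∞} (hp : p ≠ 0)
    {f : X → ℝ≥0∞} (hf : Measurable f) :
    eLpNorm f p (m.withDensity d) = eLpNorm (fun x => d x ^ (p⁻¹).toReal * f x) p m := by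
  rcases eq_or_ne p ⊤ with rfl | hpt
  · have hac : m ≪ m.withDensity d := withDensity_absolutelyContinuous' hd.aemeasurable hd0
    have hac' := withDensity_absolutelyContinuous m d
    simp only [eLpNorm_exponent_top, ENNReal.inv_top, ENNReal.toReal_zero, ENNReal.rpow_zero,
      one_mul]
    exact le_antisymm (eLpNormEssSup_mono_measure _ hac') (eLpNormEssSup_mono_measure _ hac)
  · have hq0 := ENNReal.toReal_pos hp hpt
    rw [eLpNorm_eq_lintegral_rpow_enorm_toReal hp hpt,
      eLpNorm_eq_lintegral_rpow_enorm_toReal hp hpt]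
    simp only [enorm_eq_self]
    rw [lintegral_withDensity_eq_lintegral_mul _ hd (hf.pow_const _)]
    congr 2
    funext x
    rw [Pi.mul_apply, ENNReal.mul_rpow_of_nonneg _ _ hq0.le, ← ENNReal.rpow_mul, ENNReal.toReal_inv,
      inv_mul_cancel₀ hq0.ne', ENNReal.rpow_one]

end Minkowski

/-! ### Averaging over the orthogonal group. -/

section Orthogonal

variable {n : ℕ}

instance orthHaar.instIsHaarMeasure : (orthHaar n).IsHaarMeasure :=
  inferInstanceAs (Measure.haarMeasure ⊤).IsHaarMeasure

/-- A compact group is unimodular: the right translate is again a Haar probability measure, and such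
a measure is unique. -/
theorem orthHaar_map_mul_right (h : OrthGroup n) : (orthHaar n).map (· * h) = orthHaar n := by
  have hm : Measurable fun g : OrthGroup n => g * h := (continuous_mul_const h).measurable
  have : IsProbabilityMeasure ((orthHaar n).map (· * h)) :=
    Measure.isProbabilityMeasure_map hm.aemeasurable
  have : ((orthHaar n).map (· * h)).IsHaarMeasure := Measure.isHaarMeasure_map_mul_right _ h
  exact Measure.isHaarMeasure_eq_of_isProbabilityMeasure _ _

theorem OrthGroup.norm_map (g : OrthGroup n) (x : EuclideanSpace ℝ (Fin n)) : ‖g.1 x‖ = ‖x‖ :=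
  ContinuousLinearMap.norm_map_of_mem_unitary g.2 x

theorem OrthGroup.continuous_apply :
    Continuous fun q : OrthGroup n × EuclideanSpace ℝ (Fin n) => q.1.1 q.2 :=
  (continuous_subtype_val.comp continuous_fst).clm_apply continuous_snd

theorem OrthGroup.exists_apply_eq {x y : EuclideanSpace ℝ (Fin n)} (h : ‖x‖ = ‖y‖) :
    ∃ g : OrthGroup n, g.1 x = y := by
  -- The reflection in the hyperplane orthogonal to `x - y` exchanges two vectors of equal norm.
  refine ⟨Unitary.linearIsometryEquiv.symm (ℝ ∙ (x - y))ᗮ.reflection, ?_⟩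
  rw [Unitary.coe_symm_linearIsometryEquiv_apply]
  exact Submodule.reflection_sub h

/-- The average over `O(n)` of a function of `ℝⁿ` is a radial function with the same integral. -/
theorem exists_radial_average (hn : 0 < n) {H : EuclideanSpace ℝ (Fin n) → ℝ≥0∞}
    (hH : Measurable H) :
    ∃ N : ℝ → ℝ≥0∞, Measurable N ∧
      (∀ x : EuclideanSpace ℝ (Fin n), ∫⁻ g, H (g.1 x) ∂orthHaar n = N ‖x‖) ∧
      ∫⁻ x : EuclideanSpace ℝ (Fin n), N ‖x‖ = ∫⁻ x, H x := by
  let e : EuclideanSpace ℝ (Fin n) := EuclideanSpace.single ⟨0, hn⟩ 1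
  have he : ‖e‖ = 1 := by simp [e]
  have hm : Measurable fun q : OrthGroup n × EuclideanSpace ℝ (Fin n) => H (q.1.1 q.2) :=
    hH.comp OrthGroup.continuous_apply.measurable
  have hN (x : EuclideanSpace ℝ (Fin n)) :
      ∫⁻ g, H (g.1 x) ∂orthHaar n = ∫⁻ g, H (g.1 (‖x‖ • e)) ∂orthHaar n := by
    -- Any `x` is a rotation of `‖x‖ • e`, which right invariance absorbs into `g`.
    obtain ⟨h, hh⟩ := OrthGroup.exists_apply_eq (x := ‖x‖ • e) (y := x) (by simp [norm_smul, he])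
    have hmx : Measurable fun g : OrthGroup n => H (g.1 (‖x‖ • e)) :=
      hm.comp measurable_prodMk_right
    conv_rhs => rw [← orthHaar_map_mul_right h, lintegral_map hmx
      (continuous_mul_const _).measurable]
    refine lintegral_congr fun g => ?_
    conv_lhs => rw [← hh]
    rfl
  refine ⟨fun r => ∫⁻ g, H (g.1 (r • e)) ∂orthHaar n, ?_, hN, ?_⟩
  · have : Measurable fun q : ℝ × OrthGroup n => H (q.2.1 (q.1 • e)) :=
      hm.comp (measurable_snd.prodMk (measurable_fst.smul_const e))
    exact this.lintegral_prod_right'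
  · simp only [← hN]
    rw [lintegral_lintegral_swap
      (f := fun (x : EuclideanSpace ℝ (Fin n)) (g : OrthGroup n) => H (g.1 x))
      (hm.comp measurable_swap).aemeasurable]
    have (g : OrthGroup n) : ∫⁻ x, H (g.1 x) = ∫⁻ x, H x :=
      (Unitary.linearIsometryEquiv g).measurePreserving.lintegral_comp hH
    simp [this]

/-- Between subspaces of equal dimension the restricted isometry is onto, hence preserves Lebesgue
measure. It is used both along `ξ` and along `ξᗮ`. -/
theorem OrthGroup.restrict_measurePreserving (g : OrthGroup n)
    {P Q : Submodule ℝ (EuclideanSpace ℝ (Fin n))} (h : ∀ x ∈ P, g.1 x ∈ Q)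
    (hr : finrank ℝ P = finrank ℝ Q) :
    MeasurePreserving (fun y : P => (⟨g.1 y, h y y.2⟩ : Q)) ∧
      MeasurableEmbedding (fun y : P => (⟨g.1 y, h y y.2⟩ : Q)) := by
  let l : P →ₗᵢ[ℝ] Q :=
    { toLinearMap := LinearMap.restrict (g.1 : EuclideanSpace ℝ (Fin n) →ₗ[ℝ] _) h
      norm_map' := by
        intro x
        rw [Submodule.coe_norm, Submodule.coe_norm]
        exact g.norm_map x.1 }
  let L := l.toLinearIsometryEquiv hr
  have hL : (fun y : P => (⟨g.1 y, h y y.2⟩ : Q)) = L :=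
    (l.coe_toLinearIsometryEquiv hr).symm
  rw [hL]
  exact ⟨L.measurePreserving, L.toHomeomorph.measurableEmbedding⟩

theorem Grass.rotate_apply_mem {k : ℕ} (g : OrthGroup n) (ξ : Grass n k)
    (x : EuclideanSpace ℝ (Fin n)) (hx : x ∈ ξ.1) : g.1 x ∈ (Grass.rotate g ξ).1 :=
  ⟨x, hx, rfl⟩

theorem Grass.rotate_apply_mem_orthogonal {k : ℕ} (g : OrthGroup n) (ξ : Grass n k)
    (x : EuclideanSpace ℝ (Fin n)) (hx : x ∈ ξ.1ᗮ) : g.1 x ∈ (Grass.rotate g ξ).1ᗮ := by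
  rintro _ ⟨y, hy, rfl⟩
  exact (g.inner_map y x).trans (hx y hy)

theorem Grass.finrank_orthogonal {k : ℕ} (ξ : Grass n k) : finrank ℝ ξ.1ᗮ + k = n := by
  have := ξ.1.finrank_add_finrank_orthogonal
  rw [ξ.2, finrank_euclideanSpace_fin] at this
  omega

end Orthogonal

/-! ### Parametrization of planes by rotations and offsets. -/

section Parametrization

variable {n k : ℕ}

/-- The `k`-plane `g (ℝᵏ + v)` for an orthogonal `g` and `v` orthogonal to `ℝᵏ`. -/
def AffGrass.param (h : k ≤ n) (q : OrthGroup n × (Grass.coord h).1ᗮ) : AffGrass n k :=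
  ⟨(Grass.rotate q.1 (Grass.coord h), q.1.1 q.2),
    Grass.rotate_apply_mem_orthogonal _ _ _ q.2.2⟩

theorem AffGrass.measurable_param (h : k ≤ n) : Measurable (AffGrass.param h) := by
  refine Measurable.subtype_mk (Measurable.prodMk ?_ ?_)
  · exact (Grass.continuous_rotate _).measurable.comp measurable_fst
  · exact OrthGroup.continuous_apply.measurable.comp
      (measurable_fst.prodMk (measurable_subtype_coe.comp measurable_snd))

/-- `dξ` is by definition the image of `dg`, and for each `g` the rotation identifies the fibre over
`ℝᵏ` isometrically with the fibre over `g ℝᵏ`. -/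
theorem AffGrass.measurePreserving_param (h : k ≤ n) :
    MeasurePreserving (AffGrass.param h) ((orthHaar n).prod volume) (affGrassMeasure h) := by
  refine ⟨AffGrass.measurable_param h, Measure.ext_of_lintegral _ fun F hF => ?_⟩
  have hI : Measurable fun ξ : Grass n k => ∫⁻ u : ξ.1ᗮ, F ⟨(ξ, u.1), u.2⟩ := by
    convert! (Measure.measurable_lintegral hF).comp
      (AffGrass.measurable_fibre (n := n) (k := k)) using 2 with ξ
    rw [Function.comp_apply, AffGrass.fibre, lintegral_map hF (by fun_prop)]
  rw [lintegral_map hF (AffGrass.measurable_param h), lintegral_affGrassMeasure h hF,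
    grassMeasure, lintegral_map hI (Grass.continuous_rotate _).measurable,
    lintegral_prod (fun q => F (AffGrass.param h q))
      (hF.comp (AffGrass.measurable_param h)).aemeasurable]
  refine lintegral_congr fun g => ?_
  have hr := g.restrict_measurePreserving
    (Grass.rotate_apply_mem_orthogonal g (Grass.coord h)) (by
      have h1 := (Grass.coord h).finrank_orthogonal
      have h2 := (Grass.rotate g (Grass.coord h)).finrank_orthogonal
      omega)
  exact hr.1.lintegral_comp_emb hr.2
    fun u : (Grass.rotate g (Grass.coord h)).1ᗮ => F ⟨(Grass.rotate g (Grass.coord h), u.1), u.2⟩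

/-- The point of the plane `g (ℝᵏ + v)` with the coordinate `‖v‖ y` along `g ℝᵏ`. -/
noncomputable def AffGrass.point (h : k ≤ n) (y : (Grass.coord h).1)
    (q : OrthGroup n × (Grass.coord h).1ᗮ) : EuclideanSpace ℝ (Fin n) :=
  q.1.1 (‖q.2‖ • y.1 + q.2.1)

theorem AffGrass.continuous_point (h : k ≤ n) :
    Continuous fun z : (OrthGroup n × (Grass.coord h).1ᗮ) × (Grass.coord h).1 =>
      AffGrass.point h z.2 z.1 := by
  refine OrthGroup.continuous_apply.comp (Continuous.prodMk
    (continuous_fst.comp continuous_fst) ?_)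
  exact ((continuous_snd.comp continuous_fst).norm.smul
    (continuous_subtype_val.comp continuous_snd)).add
    (continuous_subtype_val.comp (continuous_snd.comp continuous_fst))

theorem norm_smul_add_of_mem_orthogonal {P : Submodule ℝ (EuclideanSpace ℝ (Fin n))} (y : P)
    (v : Pᗮ) : ‖‖v‖ • y.1 + v.1‖ = √(1 + ‖y‖ ^ 2) * ‖v‖ := by
  have h0 : inner ℝ (‖v‖ • y.1) v.1 = 0 := by
    rw [inner_smul_left, v.2 y.1 y.2, mul_zero]
  have h1 := norm_add_sq_eq_norm_sq_add_norm_sq_of_inner_eq_zero _ _ h0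
  rw [← sq_eq_sq₀ (norm_nonneg _) (by positivity), mul_pow, Real.sq_sqrt (by positivity), pow_two,
    h1, norm_smul, norm_norm]
  simp only [Submodule.coe_norm]
  ring

theorem AffGrass.norm_point (h : k ≤ n) (y : (Grass.coord h).1)
    (q : OrthGroup n × (Grass.coord h).1ᗮ) :
    ‖AffGrass.point h y q‖ = √(1 + ‖y‖ ^ 2) * ‖q.2‖ := by
  rw [AffGrass.point, OrthGroup.norm_map, norm_smul_add_of_mem_orthogonal]

/-- The measure `|v|ᵏ dg dv` on the parameters of the `k`-planes. -/
noncomputable def AffGrass.paramMeasure (h : k ≤ n) : Measure (OrthGroup n × (Grass.coord h).1ᗮ) :=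
  ((orthHaar n).prod volume).withDensity fun q => ‖q.2‖ₑ ^ k

/-- The core of the proof. Integration over `g` replaces the test function by its radial average
`N`, evaluated at `s |v|`. The factor `|v|^k` converts the radial integral over the
`(n-k)`-dimensional `v` into one over `ℝⁿ`, at the cost of the ratio of sphere areas, and undoing
the dilation by `s` gives `s^{-n}`. -/
theorem AffGrass.map_point (hkn : k < n) (y : (Grass.coord hkn.le).1) :
    (AffGrass.paramMeasure hkn.le).map (AffGrass.point hkn.le y) =
      (ENNReal.ofReal (sphereArea (n - k) / sphereArea n) *
        (ENNReal.ofReal (√(1 + ‖y‖ ^ 2)) ^ n)⁻¹) • volume := by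
  have hrank := (Grass.coord hkn.le).finrank_orthogonal
  have hp : Measurable (AffGrass.point hkn.le y) :=
    (AffGrass.continuous_point hkn.le).measurable.comp measurable_prodMk_right
  have : Nontrivial (Grass.coord hkn.le).1ᗮ :=
    nontrivial_of_finrank_pos (R := ℝ) (by omega)
  have : Nontrivial (EuclideanSpace ℝ (Fin n)) :=
    nontrivial_of_finrank_pos (R := ℝ) (by rw [finrank_euclideanSpace_fin]; omega)
  have hs : 0 < √(1 + ‖y‖ ^ 2) := by positivity
  refine Measure.ext_of_lintegral _ fun H hH => ?_
  obtain ⟨N, hN, hNH, hNi⟩ := exists_radial_average (by omega : 0 < n) hH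
  have hHp : Measurable fun q => H (AffGrass.point hkn.le y q) := hH.comp hp
  rw [lintegral_map hH hp, AffGrass.paramMeasure,
    lintegral_withDensity_eq_lintegral_mul _ (by fun_prop) hHp,
    lintegral_smul_measure, smul_eq_mul, ← hNi,
    lintegral_prod_symm _ (by
      exact (Measurable.mul (by fun_prop) (hH.comp hp)).aemeasurable)]
  have e1 (v : (Grass.coord hkn.le).1ᗮ) :
      ∫⁻ g, ((fun q : OrthGroup n × (Grass.coord hkn.le).1ᗮ => ‖q.2‖ₑ ^ k) *
        fun q => H (AffGrass.point hkn.le y q)) (g, v) ∂orthHaar n =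
      ‖v‖ₑ ^ k * N (√(1 + ‖y‖ ^ 2) * ‖v‖) := by
    simp only [Pi.mul_apply]
    have hHv : Measurable fun g => H (AffGrass.point hkn.le y (g, v)) :=
      hHp.comp measurable_prodMk_right
    rw [lintegral_const_mul _ hHv, ← norm_smul_add_of_mem_orthogonal, ← hNH]
    rfl
  have e2 := lintegral_norm_pow_mul_fun_norm (E := EuclideanSpace ℝ (Fin n))
    (F := (Grass.coord hkn.le).1ᗮ) (k := k) (by rw [hrank, finrank_euclideanSpace_fin])
    (f := fun r => N (√(1 + ‖y‖ ^ 2) * r)) (by fun_prop)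
  have e3 := lintegral_comp_pos_smul (E := EuclideanSpace ℝ (Fin n)) hs
    (f := fun x => N ‖x‖) (by fun_prop)
  simp only [norm_smul, Real.norm_of_nonneg hs.le] at e3
  simp only [e1]
  rw [e2, e3, finrank_euclideanSpace_fin, show finrank ℝ (Grass.coord hkn.le).1ᗮ = n - k by omega,
    mul_assoc]

end Parametrization

/-! ### Measurability of the plane transform. -/

section Measurability

variable {n k : ℕ}

/-- This replaces an integral over `P` by one over a tube of radius 1 around `P` in the fixed space
`ℝⁿ`. When `P` varies, measurability in `P` then follows from Tonelli or Fubini on a product. -/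
theorem Submodule.map_orthogonalProjectionOnto_volume
    (P : Submodule ℝ (EuclideanSpace ℝ (Fin n))) :
    ((volume : Measure (EuclideanSpace ℝ (Fin n))).restrict
      {x | ‖x - P.starProjection x‖ < 1}).map P.orthogonalProjectionOnto =
      volume (Metric.ball (0 : Pᗮ) 1) • volume := by
  have hmp : MeasurePreserving (fun x => WithLp.ofLp (P.orthogonalDecomposition x))
      volume volume :=
    (WithLp.volume_preserving_ofLp _ _).comp P.orthogonalDecomposition.measurePreserving
  have hs : MeasurableSet (Set.univ ×ˢ Metric.ball (0 : Pᗮ) 1 : Set (P × Pᗮ)) :=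
    MeasurableSet.univ.prod measurableSet_ball
  have hset : {x | ‖x - P.starProjection x‖ < 1} =
      (fun x => WithLp.ofLp (P.orthogonalDecomposition x)) ⁻¹'
        (Set.univ ×ˢ Metric.ball (0 : Pᗮ) 1) := by
    ext x
    simp [Submodule.orthogonalDecomposition_apply, Submodule.orthogonalProjectionOnto_orthogonal]
  have hfun : (P.orthogonalProjectionOnto : EuclideanSpace ℝ (Fin n) → P) =
      Prod.fst ∘ fun x => WithLp.ofLp (P.orthogonalDecomposition x) := by
    funext x
    simp [Submodule.orthogonalDecomposition_apply]
  rw [hset, hfun, ← Measure.map_map measurable_fst hmp.measurable,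
    (hmp.restrict_preimage hs).map_eq, Measure.volume_eq_prod, ← Measure.prod_restrict,
    Measure.map_fst_prod]
  simp

theorem Grass.volume_ball_orthogonal (ξ : Grass n k) :
    volume (Metric.ball (0 : ξ.1ᗮ) 1) =
      volume (Metric.ball (0 : EuclideanSpace ℝ (Fin (n - k))) 1) := by
  have hr : finrank ℝ ξ.1ᗮ = n - k := by
    have := ξ.finrank_orthogonal
    omega
  let e : ξ.1ᗮ ≃ₗᵢ[ℝ] EuclideanSpace ℝ (Fin (n - k)) :=
    ((stdOrthonormalBasis ℝ ξ.1ᗮ).reindex (finCongr hr)).repr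
  rw [← e.measurePreserving.measure_preimage measurableSet_ball.nullMeasurableSet]
  simp

theorem AffGrass.measurable_starProjection_apply :
    Measurable fun q : AffGrass n k × EuclideanSpace ℝ (Fin n) =>
      q.1.1.1.1.starProjection q.2 := by
  have h : Continuous fun q : Grass n k × EuclideanSpace ℝ (Fin n) =>
      q.1.1.starProjection q.2 :=
    (Grass.continuous_starProjection.comp continuous_fst).clm_apply continuous_snd
  exact h.measurable.comp ((measurable_fst.comp
    (measurable_subtype_coe.comp measurable_fst)).prodMk measurable_snd)

theorem AffGrass.measurable_offset : Measurable fun τ : AffGrass n k => τ.1.2 :=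
  measurable_snd.comp measurable_subtype_coe

theorem AffGrass.measurableSet_tube :
    MeasurableSet {q : AffGrass n k × EuclideanSpace ℝ (Fin n) |
      ‖q.2 - q.1.1.1.1.starProjection q.2‖ < 1} :=
  (measurable_snd.sub AffGrass.measurable_starProjection_apply).norm measurableSet_Iio

theorem AffGrass.measurable_projection_add_offset :
    Measurable fun q : AffGrass n k × EuclideanSpace ℝ (Fin n) =>
      q.1.1.1.1.starProjection q.2 + q.1.1.2 :=
  AffGrass.measurable_starProjection_apply.add (AffGrass.measurable_offset.comp measurable_fst)

theorem AffGrass.measurable_lintegral {F : EuclideanSpace ℝ (Fin n) → ℝ≥0∞} (hF : Measurable F) :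
    Measurable fun τ : AffGrass n k => ∫⁻ y : τ.1.1.1, F (y.1 + τ.1.2) := by
  set c := volume (Metric.ball (0 : EuclideanSpace ℝ (Fin (n - k))) 1)
  have hc0 : c ≠ 0 := (Metric.measure_ball_pos _ _ one_pos).ne'
  have hct : c ≠ ⊤ := measure_ball_lt_top.ne
  let S := {q : AffGrass n k × EuclideanSpace ℝ (Fin n) |
    ‖q.2 - q.1.1.1.1.starProjection q.2‖ < 1}
  have hm : Measurable (S.indicator fun q => F (q.1.1.1.1.starProjection q.2 + q.1.1.2)) :=
    (hF.comp AffGrass.measurable_projection_add_offset).indicator AffGrass.measurableSet_tube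
  have key (τ : AffGrass n k) : ∫⁻ y : τ.1.1.1, F (y.1 + τ.1.2) =
      c⁻¹ * ∫⁻ x, S.indicator (fun q => F (q.1.1.1.1.starProjection q.2 + q.1.1.2)) (τ, x) := by
    have hFt : Measurable fun y : τ.1.1.1 => F (y.1 + τ.1.2) :=
      hF.comp (measurable_subtype_coe.add_const _)
    have h := congrArg (fun m => ∫⁻ y, F (y.1 + τ.1.2) ∂m)
      τ.1.1.1.map_orthogonalProjectionOnto_volume
    rw [lintegral_map hFt (by fun_prop), lintegral_smul_measure,
      Grass.volume_ball_orthogonal, smul_eq_mul,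
      ← lintegral_indicator (s := {x | ‖x - τ.1.1.1.starProjection x‖ < 1})
        (measurable_prodMk_left (x := τ) AffGrass.measurableSet_tube)] at h
    change ∫⁻ x, S.indicator (fun q => F (q.1.1.1.1.starProjection q.2 + q.1.1.2)) (τ, x) = _ at h
    rw [h, ← mul_assoc, ENNReal.inv_mul_cancel hc0 hct, one_mul]
  simp only [key]
  exact hm.lintegral_prod_right'.const_mul _

theorem stronglyMeasurable_kPlaneTransform {𝕜 : Type*} [RCLike 𝕜]
    {f : EuclideanSpace ℝ (Fin n) → 𝕜} (hf : StronglyMeasurable f) :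
    StronglyMeasurable (kPlaneTransform f : AffGrass n k → 𝕜) := by
  set c := volume.real (Metric.ball (0 : EuclideanSpace ℝ (Fin (n - k))) 1)
  have hc0 : c ≠ 0 := (ENNReal.toReal_pos (Metric.measure_ball_pos _ _ one_pos).ne'
    measure_ball_lt_top.ne).ne'
  let S := {q : AffGrass n k × EuclideanSpace ℝ (Fin n) |
    ‖q.2 - q.1.1.1.1.starProjection q.2‖ < 1}
  have hm : StronglyMeasurable
      (S.indicator fun q => f (q.1.1.1.1.starProjection q.2 + q.1.1.2)) :=
    (hf.comp_measurable AffGrass.measurable_projection_add_offset).indicator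
      AffGrass.measurableSet_tube
  have key (τ : AffGrass n k) : kPlaneTransform f τ =
      c⁻¹ • ∫ x, S.indicator (fun q => f (q.1.1.1.1.starProjection q.2 + q.1.1.2)) (τ, x) := by
    have hft : StronglyMeasurable fun y : τ.1.1.1 => f (y.1 + τ.1.2) :=
      hf.comp_measurable (measurable_subtype_coe.add_const _)
    have h := congrArg (fun m => ∫ y, f (y.1 + τ.1.2) ∂m)
      τ.1.1.1.map_orthogonalProjectionOnto_volume
    rw [integral_map (by fun_prop) hft.aestronglyMeasurable, integral_smul_measure,
      Grass.volume_ball_orthogonal,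
      ← integral_indicator (s := {x | ‖x - τ.1.1.1.starProjection x‖ < 1})
        (measurable_prodMk_left (x := τ) AffGrass.measurableSet_tube)] at h
    change ∫ x, S.indicator (fun q => f (q.1.1.1.1.starProjection q.2 + q.1.1.2)) (τ, x) =
      c • _ at h
    rw [h, smul_smul, inv_mul_cancel₀ hc0, one_smul, kPlaneTransform]
  rw [funext key]
  exact hm.integral_prod_right'.const_smul _

end Measurability

/-! ### Upper and lower bounds for nonnegative functions. -/

section Bounds

theorem eLpNorm_ennreal_const_mul {X : Type*} [MeasurableSpace X] {m : Measure X} {p : ℝ≥0∞}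
    (c : ℝ≥0∞) {f : X → ℝ≥0∞} (hf : Measurable f) :
    eLpNorm (fun x => c * f x) p m = c * eLpNorm f p m := by
  rcases eq_or_ne p 0 with rfl | hp
  · simp
  rcases eq_or_ne p ⊤ with rfl | hpt
  · simp only [eLpNorm_exponent_top, eLpNormEssSup, enorm_eq_self]
    exact ENNReal.essSup_const_mul
  · have hq0 := ENNReal.toReal_pos hp hpt
    rw [eLpNorm_eq_lintegral_rpow_enorm_toReal hp hpt,
      eLpNorm_eq_lintegral_rpow_enorm_toReal hp hpt]
    simp only [enorm_eq_self, ENNReal.mul_rpow_of_nonneg _ _ hq0.le]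
    rw [lintegral_const_mul _ (hf.pow_const _), ENNReal.mul_rpow_of_nonneg _ _ (by positivity),
      ← ENNReal.rpow_mul, mul_one_div_cancel hq0.ne', ENNReal.rpow_one]

variable {n k : ℕ}

instance AffGrass.paramMeasure.instSFinite (h : k ≤ n) : SFinite (AffGrass.paramMeasure h) :=
  inferInstanceAs (SFinite (((orthHaar n).prod volume).withDensity _))

/-- Rotate `ξ` back to `ℝᵏ` and substitute `|v| y` for `y`. The Jacobian is `|v|^k`, and `v ≠ 0`
makes the substitution legitimate. -/
theorem AffGrass.lintegral_param (h : k ≤ n) {F : EuclideanSpace ℝ (Fin n) → ℝ≥0∞}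
    (hF : Measurable F) (q : OrthGroup n × (Grass.coord h).1ᗮ) (hq : q.2 ≠ 0) :
    ∫⁻ y : (AffGrass.param h q).1.1.1, F (y.1 + (AffGrass.param h q).1.2) =
      ‖q.2‖ₑ ^ k * ∫⁻ y, F (AffGrass.point h y q) := by
  have hr := q.1.restrict_measurePreserving
    (Grass.rotate_apply_mem q.1 (Grass.coord h))
    ((Grass.coord h).2.trans (Grass.rotate q.1 (Grass.coord h)).2.symm)
  have hs : 0 < ‖q.2‖ := norm_pos_iff.2 hq
  have h1 := hr.1.lintegral_comp_emb hr.2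
    fun y : (Grass.rotate q.1 (Grass.coord h)).1 => F (y.1 + q.1.1 q.2)
  have h2 := lintegral_comp_pos_smul hs (E := (Grass.coord h).1)
    (f := fun y => F (q.1.1 y.1 + q.1.1 q.2)) (hF.comp (by fun_prop))
  rw [(Grass.coord h).2] at h2
  refine h1.symm.trans ?_
  have h3 (y : (Grass.coord h).1) : F (AffGrass.point h y q) =
      F (q.1.1 ((‖q.2‖ • y : (Grass.coord h).1) : EuclideanSpace ℝ (Fin n)) + q.1.1 q.2) := by
    rw [AffGrass.point, map_add]
    rfl
  simp only [h3]
  rw [h2, ofReal_norm, ← mul_assoc, ENNReal.mul_inv_cancel, one_mul]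
  · exact pow_ne_zero _ (by simpa using hq)
  · exact ENNReal.pow_ne_top enorm_ne_top

theorem AffGrass.ae_ne_zero (hkn : k < n) :
    ∀ᵐ q ∂(orthHaar n).prod (volume : Measure (Grass.coord hkn.le).1ᗮ), q.2 ≠ 0 := by
  have : Nontrivial (Grass.coord hkn.le).1ᗮ :=
    nontrivial_of_finrank_pos (R := ℝ) (by have := (Grass.coord hkn.le).finrank_orthogonal; omega)
  have : ∀ᵐ v : (Grass.coord hkn.le).1ᗮ, v ≠ 0 := by simp [ae_iff]
  exact Measure.quasiMeasurePreserving_snd.ae this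

/-- The weighted norm of the `k`-plane transform of a nonnegative function, in the parameters. -/
theorem eLpNorm_kPlane_eq (hkn : k < n) {p : ℝ≥0∞} (hp : p ≠ 0) {μ ν : ℝ}
    (hν : ν + k = k * (p⁻¹).toReal + μ) {F : EuclideanSpace ℝ (Fin n) → ℝ≥0∞}
    (hF : Measurable F) :
    eLpNorm (fun τ : AffGrass n k => ‖τ.1.2‖ₑ ^ ν * ∫⁻ y : τ.1.1.1, F (y.1 + τ.1.2)) p
      (affGrassMeasure hkn.le) =
    eLpNorm (fun q => ∫⁻ y, ‖q.2‖ₑ ^ μ * F (AffGrass.point hkn.le y q)) p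
      (AffGrass.paramMeasure hkn.le) := by
  have hm : Measurable fun τ : AffGrass n k => ‖τ.1.2‖ₑ ^ ν * ∫⁻ y : τ.1.1.1, F (y.1 + τ.1.2) :=
    (AffGrass.measurable_offset.enorm.pow_const ν).mul (AffGrass.measurable_lintegral hF)
  have hFp : Measurable fun z : (OrthGroup n × (Grass.coord hkn.le).1ᗮ) × (Grass.coord hkn.le).1 =>
      F (AffGrass.point hkn.le z.2 z.1) :=
    hF.comp (AffGrass.continuous_point hkn.le).measurable
  have hm' : Measurable fun q => ∫⁻ y, ‖q.2‖ₑ ^ μ * F (AffGrass.point hkn.le y q) :=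
    Measurable.lintegral_prod_right' (Measurable.mul
      ((measurable_snd.comp measurable_fst).enorm.pow_const μ) hFp)
  rw [← eLpNorm_comp_measurePreserving hm.aestronglyMeasurable
    (AffGrass.measurePreserving_param hkn.le), AffGrass.paramMeasure,
    eLpNorm_withDensity (by fun_prop) ?_ hp hm']
  · refine eLpNorm_congr_ae ?_
    filter_upwards [AffGrass.ae_ne_zero hkn] with q hq
    have h0 : ‖q.2‖ₑ ≠ 0 := by simpa using hq
    have hFq : Measurable fun y => F (AffGrass.point hkn.le y q) := hFp.comp measurable_prodMk_left
    -- Powers of `|v|`: `ν` from the weight and `k` from the Jacobian on the left, `k/p` from the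
    -- density and `μ` on the right. They agree by `hν`.
    rw [Function.comp_apply, AffGrass.lintegral_param hkn.le hF q hq,
      lintegral_const_mul _ hFq, ← mul_assoc, ← mul_assoc, ← ENNReal.rpow_natCast,
      ← ENNReal.rpow_mul, ← ENNReal.rpow_add _ _ h0 enorm_ne_top, ← hν,
      ENNReal.rpow_add _ _ h0 enorm_ne_top]
    congr 3
    have := congrArg ENNReal.ofReal (q.1.norm_map q.2)
    rwa [ofReal_norm, ofReal_norm] at this
  · filter_upwards [AffGrass.ae_ne_zero hkn] with q hq
    exact pow_ne_zero _ (by simpa using hq)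

/-- Since `|v| = s⁻¹ |point|`, the weight contributes `s^{-μ}`; the pushforward of the measure
contributes the `p`-th root of its constant, hence `s^{-n/p}` and the ratio of areas. -/
theorem eLpNorm_point (hkn : k < n) (p : ℝ≥0∞) {μ : ℝ}
    {F : EuclideanSpace ℝ (Fin n) → ℝ≥0∞} (hF : Measurable F) (y : (Grass.coord hkn.le).1) :
    eLpNorm (fun q => ‖q.2‖ₑ ^ μ * F (AffGrass.point hkn.le y q)) p
      (AffGrass.paramMeasure hkn.le) =
    ENNReal.ofReal ((1 + ‖y‖ ^ 2) ^ (-(μ + n * (p⁻¹).toReal) / 2)) *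
      (ENNReal.ofReal (sphereArea (n - k) / sphereArea n) ^ (p⁻¹).toReal *
        eLpNorm (fun x => ‖x‖ₑ ^ μ * F x) p volume) := by
  set s := √(1 + ‖y‖ ^ 2)
  have hs : 0 < s := by positivity
  have hp : Measurable (AffGrass.point hkn.le y) :=
    (AffGrass.continuous_point hkn.le).measurable.comp measurable_prodMk_right
  have hH : Measurable fun x : EuclideanSpace ℝ (Fin n) => ‖x‖ₑ ^ μ * F x :=
    (measurable_enorm.pow_const μ).mul hF
  have hHp : Measurable fun q =>
      ‖AffGrass.point hkn.le y q‖ₑ ^ μ * F (AffGrass.point hkn.le y q) := hH.comp hp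
  have hs0 : ENNReal.ofReal s ≠ 0 := by simpa using hs
  have hρ : ENNReal.ofReal (sphereArea (n - k) / sphereArea n) ≠ 0 := by
    have := div_pos (sphereArea_pos (Nat.sub_pos_of_lt hkn)) (sphereArea_pos (d := n) (by omega))
    simpa using this
  have e (q : OrthGroup n × (Grass.coord hkn.le).1ᗮ) :
      ‖q.2‖ₑ ^ μ * F (AffGrass.point hkn.le y q) =
      ENNReal.ofReal s ^ (-μ) *
        (‖AffGrass.point hkn.le y q‖ₑ ^ μ * F (AffGrass.point hkn.le y q)) := by
    rw [← ofReal_norm (AffGrass.point hkn.le y q), AffGrass.norm_point,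
      ENNReal.ofReal_mul hs.le, ofReal_norm, ENNReal.mul_rpow_of_ne_top ENNReal.ofReal_ne_top
      enorm_ne_top, ← mul_assoc, ← mul_assoc, ← ENNReal.rpow_add _ _ hs0 ENNReal.ofReal_ne_top]
    simp
  have h1 : eLpNorm (fun q => ‖AffGrass.point hkn.le y q‖ₑ ^ μ * F (AffGrass.point hkn.le y q)) p
      (AffGrass.paramMeasure hkn.le) = _ :=
    (eLpNorm_map_measure hH.aestronglyMeasurable hp.aemeasurable (p := p)).symm
  simp only [e]
  rw [eLpNorm_ennreal_const_mul _ hHp, h1, AffGrass.map_point, eLpNorm_smul_measure_of_ne_zero,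
    smul_eq_mul, one_div, ENNReal.mul_rpow_of_nonneg _ _ ENNReal.toReal_nonneg,
    mul_comm (_ ^ (p⁻¹).toReal) ((_ : ℝ≥0∞) ^ (p⁻¹).toReal), mul_assoc, ← mul_assoc]
  · congr 1
    rw [← ENNReal.rpow_natCast, ← ENNReal.rpow_neg, ← ENNReal.rpow_mul,
      ← ENNReal.rpow_add _ _ hs0 ENNReal.ofReal_ne_top, ENNReal.ofReal_rpow_of_pos hs,
      show s = (1 + ‖y‖ ^ 2) ^ (1 / 2 : ℝ) from Real.sqrt_eq_rpow _, ← Real.rpow_mul (by positivity)]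
    congr 2
    ring
  · exact mul_ne_zero hρ (ENNReal.inv_ne_zero.2 (ENNReal.pow_ne_top ENNReal.ofReal_ne_top))
  · exact hkn

theorem eLpNorm_kPlane_le (hkn : k < n) {p : ℝ≥0∞} (hp : 1 ≤ p) {μ ν : ℝ}
    (hν : ν + k = k * (p⁻¹).toReal + μ) {F : EuclideanSpace ℝ (Fin n) → ℝ≥0∞}
    (hF : Measurable F) :
    eLpNorm (fun τ : AffGrass n k => ‖τ.1.2‖ₑ ^ ν * ∫⁻ y : τ.1.1.1, F (y.1 + τ.1.2)) p
      (affGrassMeasure hkn.le) ≤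
    (∫⁻ y : (Grass.coord hkn.le).1,
        ENNReal.ofReal ((1 + ‖y‖ ^ 2) ^ (-(μ + n * (p⁻¹).toReal) / 2))) *
      (ENNReal.ofReal (sphereArea (n - k) / sphereArea n) ^ (p⁻¹).toReal *
        eLpNorm (fun x => ‖x‖ₑ ^ μ * F x) p volume) := by
  rw [eLpNorm_kPlane_eq hkn (zero_lt_one.trans_le hp).ne' hν hF]
  refine eLpNorm_lintegral_le ?_ (by fun_prop) (fun y => ?_) (fun y => ENNReal.ofReal_ne_top) hp
    fun y => (eLpNorm_point hkn p hF y).le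
  · exact Measurable.mul ((measurable_snd.comp measurable_fst).enorm.pow_const μ)
      (hF.comp (AffGrass.continuous_point hkn.le).measurable)
  · have : 0 < (1 + ‖y‖ ^ 2) ^ (-(μ + n * (p⁻¹).toReal) / 2) := by positivity
    simpa using this

/-- The points at `y` and at `0` have norms in the ratio `s ≥ 1`, so `hFr` bounds the integrand
below by `s^{-r}` times its value at `y = 0`. Integration in `y` then separates from the norm in
`(g, v)`, which reverses Minkowski up to the change of exponent. -/
theorem le_eLpNorm_kPlane (hkn : k < n) {p : ℝ≥0∞} (hp : 1 ≤ p) {μ ν r : ℝ}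
    (hν : ν + k = k * (p⁻¹).toReal + μ) {F : EuclideanSpace ℝ (Fin n) → ℝ≥0∞}
    (hF : Measurable F)
    (hFr : ∀ x x' s, 1 ≤ s → ‖x'‖ = s * ‖x‖ → ENNReal.ofReal (s ^ (-r)) * F x ≤ F x') :
    (∫⁻ y : (Grass.coord hkn.le).1, ENNReal.ofReal ((1 + ‖y‖ ^ 2) ^ (-r / 2))) *
      (ENNReal.ofReal (sphereArea (n - k) / sphereArea n) ^ (p⁻¹).toReal *
        eLpNorm (fun x => ‖x‖ₑ ^ μ * F x) p volume) ≤
    eLpNorm (fun τ : AffGrass n k => ‖τ.1.2‖ₑ ^ ν * ∫⁻ y : τ.1.1.1, F (y.1 + τ.1.2)) p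
      (affGrassMeasure hkn.le) := by
  have h0 := eLpNorm_point hkn p (μ := μ) hF 0
  have hFp : Measurable fun q => F (AffGrass.point hkn.le 0 q) :=
    hF.comp ((AffGrass.continuous_point hkn.le).measurable.comp measurable_prodMk_right)
  have hm : Measurable fun q : OrthGroup n × (Grass.coord hkn.le).1ᗮ =>
      ‖q.2‖ₑ ^ μ * F (AffGrass.point hkn.le 0 q) :=
    (measurable_snd.enorm.pow_const μ).mul hFp
  simp only [norm_zero, ne_eq, OfNat.ofNat_ne_zero, not_false_eq_true, zero_pow, add_zero,
    Real.one_rpow, ENNReal.ofReal_one, one_mul] at h0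
  rw [eLpNorm_kPlane_eq hkn (zero_lt_one.trans_le hp).ne' hν hF, ← h0,
    ← eLpNorm_ennreal_const_mul _ hm]
  refine eLpNorm_mono_enorm fun q => ?_
  rw [enorm_eq_self, enorm_eq_self, ← lintegral_mul_const _ (by fun_prop)]
  refine lintegral_mono fun y => ?_
  rw [mul_left_comm]
  gcongr
  have hs : 1 ≤ √(1 + ‖y‖ ^ 2) := Real.one_le_sqrt.2 (by nlinarith [sq_nonneg ‖y‖])
  have := hFr (AffGrass.point hkn.le 0 q) (AffGrass.point hkn.le y q) _ hs (by
    rw [AffGrass.norm_point, AffGrass.norm_point]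
    simp)
  rw [Real.sqrt_eq_rpow, ← Real.rpow_mul (by positivity)] at this
  convert! this using 4
  ring

end Bounds

/-! ### Null sets and absolute convergence. -/

section AlmostEverywhere

theorem ae_ne_top_of_eLpNorm_ne_top {X : Type*} [MeasurableSpace X] {m : Measure X} {p : ℝ≥0∞}
    (hp : p ≠ 0) {f : X → ℝ≥0∞} (hf : Measurable f) (h : eLpNorm f p m ≠ ⊤) :
    ∀ᵐ x ∂m, f x ≠ ⊤ := by
  rcases eq_or_ne p ⊤ with rfl | hpt
  · rw [eLpNorm_exponent_top] at h
    filter_upwards [ae_le_eLpNormEssSup (f := f) (μ := m)] with x hx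
    exact (hx.trans_lt h.lt_top).ne
  · have hq0 := ENNReal.toReal_pos hp hpt
    rw [eLpNorm_eq_lintegral_rpow_enorm_toReal hp hpt] at h
    simp only [enorm_eq_self] at h
    have h' : ∫⁻ x, f x ^ p.toReal ∂m ≠ ⊤ := fun h0 => h (by
      rw [h0, ENNReal.top_rpow_of_pos (by positivity)])
    filter_upwards [ae_lt_top (hf.pow_const _) h'] with x hx h0
    rw [h0, ENNReal.top_rpow_of_pos hq0] at hx
    exact lt_irrefl _ hx

/-- The two powers differ at `u x = 0` for negative `c`: the real one is 0 and the extended one is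
`⊤`. Hence the hypothesis `hu`. -/
theorem eLpNorm_norm_rpow_smul {X E 𝕜 : Type*} [MeasurableSpace X] [NormedAddCommGroup E]
    [RCLike 𝕜] {m : Measure X} (p : ℝ≥0∞) (c : ℝ) {u : X → E} (hu : ∀ᵐ x ∂m, u x ≠ 0)
    (f : X → 𝕜) :
    eLpNorm (fun x => ‖u x‖ ^ c • f x) p m = eLpNorm (fun x => ‖u x‖ₑ ^ c * ‖f x‖ₑ) p m := by
  refine eLpNorm_congr_enorm_ae ?_
  filter_upwards [hu] with x hx
  have h0 : 0 < ‖u x‖ := norm_pos_iff.2 hx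
  rw [enorm_smul, enorm_eq_self, ← ofReal_norm (‖u x‖ ^ c), Real.norm_of_nonneg (by positivity),
    ← ENNReal.ofReal_rpow_of_pos h0, ofReal_norm]

theorem EuclideanSpace.ae_ne_zero {n : ℕ} (hn : 0 < n) :
    ∀ᵐ x : EuclideanSpace ℝ (Fin n), x ≠ 0 := by
  have : Nontrivial (EuclideanSpace ℝ (Fin n)) :=
    nontrivial_of_finrank_pos (R := ℝ) (by rwa [finrank_euclideanSpace_fin])
  simp [ae_iff]

variable {n k : ℕ}

theorem AffGrass.ae_offset_ne_zero (hkn : k < n) :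
    ∀ᵐ τ ∂affGrassMeasure hkn.le, τ.1.2 ≠ 0 := by
  have hs : MeasurableSet {τ : AffGrass n k | τ.1.2 ≠ 0} :=
    AffGrass.measurable_offset (measurableSet_singleton 0).compl
  rw [← (AffGrass.measurePreserving_param hkn.le).map_eq,
    ae_map_iff (AffGrass.measurable_param hkn.le).aemeasurable hs]
  filter_upwards [AffGrass.ae_ne_zero hkn] with q hq h0
  have h1 : q.1.1 q.2.1 = 0 := h0
  have h2 := q.1.norm_map q.2.1
  rw [h1, norm_zero] at h2
  exact hq (norm_eq_zero.1 h2.symm)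

theorem AffGrass.eLpNorm_dist_rpow_smul {𝕜 : Type*} [RCLike 𝕜] (hkn : k < n) (p : ℝ≥0∞) (c : ℝ)
    (f : AffGrass n k → 𝕜) :
    eLpNorm (fun τ => τ.dist ^ c • f τ) p (affGrassMeasure hkn.le) =
      eLpNorm (fun τ => ‖τ.1.2‖ₑ ^ c * ‖f τ‖ₑ) p (affGrassMeasure hkn.le) := by
  simp only [AffGrass.dist_eq]
  exact eLpNorm_norm_rpow_smul p c (AffGrass.ae_offset_ne_zero hkn) f

/-- Almost everywhere equal functions are almost everywhere equal on almost every `k`-plane. -/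
theorem ae_ae_eq_kPlane {β : Type*} (hkn : k < n) {f g : EuclideanSpace ℝ (Fin n) → β}
    (h : f =ᵐ[volume] g) :
    ∀ᵐ τ ∂affGrassMeasure hkn.le,
      (fun y : τ.1.1.1 => f (y.1 + τ.1.2)) =ᵐ[volume] fun y => g (y.1 + τ.1.2) := by
  set N := toMeasurable volume {x | f x ≠ g x}
  have hN : MeasurableSet N := measurableSet_toMeasurable _ _
  have hN0 : volume N = 0 := by rw [measure_toMeasurable]; exact h
  have hF : Measurable (N.indicator (1 : EuclideanSpace ℝ (Fin n) → ℝ≥0∞)) :=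
    measurable_one.indicator hN
  -- The bound for `p = 1` and zero weights, applied to the indicator of a null set, shows that
  -- almost every plane meets it in a null set.
  have hle := eLpNorm_kPlane_le hkn (le_refl (1 : ℝ≥0∞)) (μ := 0) (ν := 0) (by simp) hF
  have hz : eLpNorm (fun x => ‖x‖ₑ ^ (0 : ℝ) * N.indicator 1 x) 1 volume = 0 := by
    simp [eLpNorm_one_eq_lintegral_enorm, lintegral_indicator_one hN, hN0]
  rw [hz, mul_zero, mul_zero, nonpos_iff_eq_zero, eLpNorm_one_eq_lintegral_enorm] at hle
  simp only [ENNReal.rpow_zero, one_mul, enorm_eq_self] at hle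
  rw [lintegral_eq_zero_iff (AffGrass.measurable_lintegral hF)] at hle
  filter_upwards [hle] with τ hτ
  have hNτ : MeasurableSet ((fun y : τ.1.1.1 => y.1 + τ.1.2) ⁻¹' N) :=
    (measurable_subtype_coe.add_const _) hN
  have hi : ∫⁻ y : τ.1.1.1, ((fun y : τ.1.1.1 => y.1 + τ.1.2) ⁻¹' N).indicator 1 y = 0 := hτ
  rw [lintegral_indicator_one hNτ] at hi
  refine measure_mono_null (fun y hy => ?_) hi
  exact subset_toMeasurable volume _ hy

theorem ae_integrable_kPlane {𝕜 : Type*} [RCLike 𝕜] (hkn : k < n) {p : ℝ≥0∞} (hp : 1 ≤ p)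
    {μ ν : ℝ} (hν : ν + k = k * (p⁻¹).toReal + μ) (hμ : (k : ℝ) < μ + n * (p⁻¹).toReal)
    {f : EuclideanSpace ℝ (Fin n) → 𝕜} (hf : StronglyMeasurable f)
    (hfp : eLpNorm (fun x => ‖x‖ₑ ^ μ * ‖f x‖ₑ) p volume ≠ ⊤) :
    ∀ᵐ τ ∂affGrassMeasure hkn.le,
      Integrable (fun y : τ.1.1.1 => f (y.1 + τ.1.2)) volume := by
  have hF : Measurable fun x => ‖f x‖ₑ := hf.enorm
  have hle := eLpNorm_kPlane_le hkn hp hν hF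
  rw [lintegral_one_add_norm_sq_rpow (by rwa [(Grass.coord hkn.le).2])] at hle
  have hfin := ne_top_of_le_ne_top (ENNReal.mul_ne_top ENNReal.ofReal_ne_top
    (ENNReal.mul_ne_top (ENNReal.rpow_ne_top_of_nonneg ENNReal.toReal_nonneg
      ENNReal.ofReal_ne_top) hfp)) hle
  have hm : Measurable fun τ : AffGrass n k => ‖τ.1.2‖ₑ ^ ν * ∫⁻ y : τ.1.1.1, ‖f (y.1 + τ.1.2)‖ₑ :=
    (AffGrass.measurable_offset.enorm.pow_const ν).mul (AffGrass.measurable_lintegral hF)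
  -- A finite weighted norm makes `|τ|^ν ∫ ‖f‖` finite almost everywhere. Off the null set of planes
  -- through the origin the weight is nonzero, so the integral itself is finite.
  filter_upwards [ae_ne_top_of_eLpNorm_ne_top (zero_lt_one.trans_le hp).ne' hm hfin,
    AffGrass.ae_offset_ne_zero hkn] with τ h1 h2
  refine ⟨(hf.comp_measurable (measurable_subtype_coe.add_const _)).aestronglyMeasurable, ?_⟩
  rw [HasFiniteIntegral, lt_top_iff_ne_top]
  intro h3
  refine h1 ?_
  rw [h3, ENNReal.mul_top]
  exact (ENNReal.rpow_pos (by simpa [pos_iff_ne_zero] using h2) enorm_ne_top).ne'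

end AlmostEverywhere

/-! ### The operator on the weighted spaces. -/

section Operator

/-- The norm of the `k`-plane transform, as a function of `t = μ + n / p` and `a = 1 / p`. -/
noncomputable def kPlaneNorm (n k : ℕ) (a t : ℝ) : ℝ :=
  Real.pi ^ ((k : ℝ) / 2) * (sphereArea (n - k) / sphereArea n) ^ a *
    (Real.Gamma ((t - k) / 2) / Real.Gamma (t / 2))

variable {n k : ℕ}

theorem kPlaneNorm_pos (hkn : k < n) (a : ℝ) {t : ℝ} (ht : (k : ℝ) < t) :
    0 < kPlaneNorm n k a t := by
  have h1 := sphereArea_pos (Nat.sub_pos_of_lt hkn)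
  have h2 := sphereArea_pos (d := n) (by omega)
  have h3 := Real.Gamma_pos_of_pos (show 0 < (t - k) / 2 by linarith)
  have h4 := Real.Gamma_pos_of_pos
    (show 0 < t / 2 by linarith [(Nat.cast_nonneg k : (0 : ℝ) ≤ k)])
  unfold kPlaneNorm
  positivity

theorem continuousAt_kPlaneNorm (a : ℝ) {t : ℝ} (ht : (k : ℝ) < t) :
    ContinuousAt (kPlaneNorm n k a) t := by
  have h3 : 0 < (t - k) / 2 := by linarith
  have h4 : 0 < t / 2 := by linarith [(Nat.cast_nonneg k : (0 : ℝ) ≤ k)]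
  have c {x : ℝ} (hx : 0 < x) : ContinuousAt Real.Gamma x :=
    (Real.differentiableAt_Gamma fun m => by
      have := (Nat.cast_nonneg m : (0 : ℝ) ≤ m)
      linarith).continuousAt
  have c3 : ContinuousAt (fun t : ℝ => Real.Gamma ((t - k) / 2)) t :=
    ContinuousAt.comp (f := fun t : ℝ => (t - k) / 2) (c h3) (by fun_prop)
  have c4 : ContinuousAt (fun t : ℝ => Real.Gamma (t / 2)) t :=
    ContinuousAt.comp (f := fun t : ℝ => t / 2) (c h4) (by fun_prop)
  exact (continuousAt_const (y := Real.pi ^ ((k : ℝ) / 2) *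
    (sphereArea (n - k) / sphereArea n) ^ a)).mul (c3.div c4 (Real.Gamma_pos_of_pos h4).ne')

theorem lintegral_mul_eq_kPlaneNorm (hkn : k < n) (a : ℝ) (ha : 0 ≤ a) {t : ℝ} (ht : (k : ℝ) < t)
    (A : ℝ≥0∞) :
    (∫⁻ y : (Grass.coord hkn.le).1, ENNReal.ofReal ((1 + ‖y‖ ^ 2) ^ (-t / 2))) *
      (ENNReal.ofReal (sphereArea (n - k) / sphereArea n) ^ a * A) =
      ENNReal.ofReal (kPlaneNorm n k a t) * A := by
  have hd : (0 : ℝ) ≤ sphereArea (n - k) / sphereArea n :=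
    (div_pos (sphereArea_pos (Nat.sub_pos_of_lt hkn)) (sphereArea_pos (d := n) (by omega))).le
  rw [lintegral_one_add_norm_sq_rpow (by rwa [(Grass.coord hkn.le).2]), (Grass.coord hkn.le).2,
    ENNReal.ofReal_rpow_of_nonneg hd ha, ← mul_assoc, kPlaneNorm,
    ← ENNReal.ofReal_mul' (by positivity)]
  congr 2
  ring

variable {𝕜 : Type*} [RCLike 𝕜]

theorem eLpNorm_kPlaneTransform_le (hkn : k < n) {p : ℝ≥0∞} (hp : 1 ≤ p) {μ ν : ℝ}
    (hν : ν + k = k * (p⁻¹).toReal + μ) (hμ : (k : ℝ) < μ + n * (p⁻¹).toReal)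
    {f : EuclideanSpace ℝ (Fin n) → 𝕜} (hf : StronglyMeasurable f) :
    eLpNorm (fun τ => τ.dist ^ ν • kPlaneTransform f τ) p (affGrassMeasure hkn.le) ≤
      ENNReal.ofReal (kPlaneNorm n k (p⁻¹).toReal (μ + n * (p⁻¹).toReal)) *
        eLpNorm (fun x => ‖x‖ ^ μ • f x) p volume := by
  have hle := eLpNorm_kPlane_le hkn hp hν (F := fun x => ‖f x‖ₑ) hf.enorm
  rw [lintegral_mul_eq_kPlaneNorm hkn _ ENNReal.toReal_nonneg hμ] at hle
  rw [AffGrass.eLpNorm_dist_rpow_smul hkn,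
    eLpNorm_norm_rpow_smul p μ (EuclideanSpace.ae_ne_zero (by omega))]
  refine le_trans (eLpNorm_mono_enorm fun τ => ?_) hle
  rw [enorm_eq_self, enorm_eq_self]
  gcongr
  exact enorm_integral_le_lintegral_enorm _

theorem weightedLp.enorm_eq {X : Type*} [MeasurableSpace X] {w : X → ℝ} {p : ℝ≥0∞}
    [Fact (1 ≤ p)] {m : Measure X} (f : weightedLp 𝕜 w p m) :
    ENNReal.ofReal ‖f‖ = eLpNorm (fun x => w x • (f : X →ₘ[m] 𝕜) x) p m := by
  change ENNReal.ofReal ‖MemLp.toLp _ (weightedLp.memLp f)‖ = _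
  rw [Lp.norm_toLp, ENNReal.ofReal_toReal (weightedLp.memLp f).2.ne]

theorem weightedLp.eLpNorm_enorm_ne_top {p : ℝ≥0∞} (hn : 0 < n) {μ : ℝ}
    (f : weightedLp 𝕜 (fun x : EuclideanSpace ℝ (Fin n) => ‖x‖ ^ μ) p volume) :
    eLpNorm (fun x => ‖x‖ₑ ^ μ * ‖(f : EuclideanSpace ℝ (Fin n) →ₘ[volume] 𝕜) x‖ₑ) p volume ≠ ⊤ := by
  rw [← eLpNorm_norm_rpow_smul p μ (EuclideanSpace.ae_ne_zero hn)]
  exact (weightedLp.memLp f).2.ne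

/-- The class of the `k`-plane transform of a function of a weighted space. -/
noncomputable def kPlaneLp (𝕜 : Type*) [RCLike 𝕜] (hkn : k < n) {p : ℝ≥0∞} (hp : 1 ≤ p) {μ ν : ℝ}
    (hν : ν + k = k * (p⁻¹).toReal + μ) (hμ : (k : ℝ) < μ + n * (p⁻¹).toReal) :
    weightedLp 𝕜 (fun x : EuclideanSpace ℝ (Fin n) => ‖x‖ ^ μ) p volume →ₗ[𝕜]
      weightedLp 𝕜 (fun τ : AffGrass n k => τ.dist ^ ν) p (affGrassMeasure hkn.le) where
  toFun f := ⟨AEEqFun.mk (kPlaneTransform (f : EuclideanSpace ℝ (Fin n) →ₘ[volume] 𝕜))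
      (stronglyMeasurable_kPlaneTransform f.1.stronglyMeasurable).aestronglyMeasurable, by
    have hm := stronglyMeasurable_kPlaneTransform (k := k) f.1.stronglyMeasurable
    have hd : Measurable fun τ : AffGrass n k => τ.dist ^ ν := by
      simp only [AffGrass.dist_eq]
      exact AffGrass.measurable_offset.norm.pow_const ν
    refine MemLp.ae_eq (f := fun τ => τ.dist ^ ν • kPlaneTransform f.1 τ) ?_
      ⟨(hd.stronglyMeasurable.smul hm).aestronglyMeasurable,
        (eLpNorm_kPlaneTransform_le hkn hp hν hμ f.1.stronglyMeasurable).trans_lt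
          (ENNReal.mul_lt_top ENNReal.ofReal_lt_top (weightedLp.memLp f).2)⟩
    filter_upwards [AEEqFun.coeFn_mk _ hm.aestronglyMeasurable] with τ hτ
    rw [hτ]⟩
  map_add' f g := by
    refine Subtype.ext ?_
    change AEEqFun.mk _ _ = AEEqFun.mk _ _ + AEEqFun.mk _ _
    rw [AEEqFun.mk_add_mk, AEEqFun.mk_eq_mk]
    have hn : 0 < n := by omega
    -- Additivity of the integral needs absolute convergence of both transforms; for scalars below,
    -- equality of representatives on almost every plane suffices.
    filter_upwards [ae_ae_eq_kPlane hkn (AEEqFun.coeFn_add f.1 g.1),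
      ae_integrable_kPlane hkn hp hν hμ f.1.stronglyMeasurable
        (weightedLp.eLpNorm_enorm_ne_top hn f),
      ae_integrable_kPlane hkn hp hν hμ g.1.stronglyMeasurable
        (weightedLp.eLpNorm_enorm_ne_top hn g)] with τ h1 h2 h3
    exact (integral_congr_ae h1).trans (integral_add h2 h3)
  map_smul' c f := by
    refine Subtype.ext ?_
    change AEEqFun.mk _ _ = c • AEEqFun.mk _ _
    rw [AEEqFun.smul_mk, AEEqFun.mk_eq_mk]
    filter_upwards [ae_ae_eq_kPlane hkn (AEEqFun.coeFn_smul c f.1)] with τ h1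
    exact (integral_congr_ae h1).trans (integral_smul c _)

theorem coeFn_kPlaneLp (hkn : k < n) {p : ℝ≥0∞} (hp : 1 ≤ p) {μ ν : ℝ}
    (hν : ν + k = k * (p⁻¹).toReal + μ) (hμ : (k : ℝ) < μ + n * (p⁻¹).toReal)
    (f : weightedLp 𝕜 (fun x : EuclideanSpace ℝ (Fin n) => ‖x‖ ^ μ) p volume) :
    (kPlaneLp 𝕜 hkn hp hν hμ f : AffGrass n k →ₘ[affGrassMeasure hkn.le] 𝕜)
      =ᵐ[affGrassMeasure hkn.le]
        kPlaneTransform (f : EuclideanSpace ℝ (Fin n) →ₘ[volume] 𝕜) :=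
  AEEqFun.coeFn_mk _ _

theorem enorm_kPlaneLp (hkn : k < n) {p : ℝ≥0∞} [hp : Fact (1 ≤ p)] {μ ν : ℝ}
    (hν : ν + k = k * (p⁻¹).toReal + μ) (hμ : (k : ℝ) < μ + n * (p⁻¹).toReal)
    (f : weightedLp 𝕜 (fun x : EuclideanSpace ℝ (Fin n) => ‖x‖ ^ μ) p volume) :
    ENNReal.ofReal ‖kPlaneLp 𝕜 hkn hp.out hν hμ f‖ =
      eLpNorm (fun τ => τ.dist ^ ν •
        kPlaneTransform (f : EuclideanSpace ℝ (Fin n) →ₘ[volume] 𝕜) τ) p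
        (affGrassMeasure hkn.le) := by
  rw [weightedLp.enorm_eq]
  refine eLpNorm_congr_ae ?_
  filter_upwards [coeFn_kPlaneLp hkn hp.out hν hμ f] with τ hτ
  rw [hτ]

theorem norm_kPlaneLp_le (hkn : k < n) {p : ℝ≥0∞} [hp : Fact (1 ≤ p)] {μ ν : ℝ}
    (hν : ν + k = k * (p⁻¹).toReal + μ) (hμ : (k : ℝ) < μ + n * (p⁻¹).toReal)
    (f : weightedLp 𝕜 (fun x : EuclideanSpace ℝ (Fin n) => ‖x‖ ^ μ) p volume) :
    ‖kPlaneLp 𝕜 hkn hp.out hν hμ f‖ ≤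
      kPlaneNorm n k (p⁻¹).toReal (μ + n * (p⁻¹).toReal) * ‖f‖ := by
  have h0 := (kPlaneNorm_pos hkn (p⁻¹).toReal hμ).le
  rw [← ENNReal.ofReal_le_ofReal_iff (by positivity), ENNReal.ofReal_mul h0, enorm_kPlaneLp,
    weightedLp.enorm_eq]
  exact eLpNorm_kPlaneTransform_le hkn hp.out hν hμ f.1.stronglyMeasurable

end Operator

/-! ### Sharpness through radial tails. -/

section TestFunction

variable {n k : ℕ}

/-- The function `|x|^{-r}` outside of the unit ball. -/
noncomputable def radialTail (n : ℕ) (r : ℝ) : EuclideanSpace ℝ (Fin n) → ℝ :=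
  {x | 1 < ‖x‖}.indicator fun x => ‖x‖ ^ (-r)

theorem radialTail_nonneg (r : ℝ) (x : EuclideanSpace ℝ (Fin n)) : 0 ≤ radialTail n r x :=
  Set.indicator_nonneg (fun _ _ => by positivity) x

theorem measurable_radialTail (r : ℝ) : Measurable (radialTail n r) :=
  (measurable_norm.pow_const _).indicator (measurable_norm measurableSet_Ioi)

/-- Dilation by `s ≥ 1` maps the exterior of the unit ball into itself, where the tail is
homogeneous of degree `-r`. -/
theorem radialTail_mul_le {r s : ℝ} {x x' : EuclideanSpace ℝ (Fin n)} (hs : 1 ≤ s)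
    (h : ‖x'‖ = s * ‖x‖) : s ^ (-r) * radialTail n r x ≤ radialTail n r x' := by
  by_cases hx : 1 < ‖x‖
  · have hx' : 1 < ‖x'‖ := by rw [h]; nlinarith
    rw [radialTail, Set.indicator_of_mem (by exact hx), Set.indicator_of_mem (by exact hx'), h,
      Real.mul_rpow (by positivity) (norm_nonneg _)]
  · rw [radialTail, Set.indicator_of_notMem (by exact hx), mul_zero]
    exact radialTail_nonneg r x'

theorem enorm_rpow_mul_radialTail (μ r : ℝ) (x : EuclideanSpace ℝ (Fin n)) :
    ‖x‖ₑ ^ μ * ‖radialTail n r x‖ₑ = ‖radialTail n (r - μ) x‖ₑ := by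
  by_cases hx : 1 < ‖x‖
  · have h0 : 0 < ‖x‖ := by linarith
    rw [radialTail, radialTail, Set.indicator_of_mem (by exact hx),
      Set.indicator_of_mem (by exact hx), Real.enorm_of_nonneg (by positivity),
      Real.enorm_of_nonneg (by positivity), ← ofReal_norm, ENNReal.ofReal_rpow_of_pos h0,
      ← ENNReal.ofReal_mul (by positivity), ← Real.rpow_add h0]
    congr 2
    ring
  · rw [radialTail, radialTail, Set.indicator_of_notMem (by exact hx),
      Set.indicator_of_notMem (by exact hx), enorm_zero, mul_zero]

theorem eLpNorm_radialTail_ne_top {p : ℝ≥0∞} (hp : p ≠ 0) {s : ℝ} (hs0 : 0 ≤ s)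
    (hs : n * (p⁻¹).toReal < s) : eLpNorm (radialTail n s) p volume ≠ ⊤ := by
  have hle (x : EuclideanSpace ℝ (Fin n)) :
      ‖radialTail n s x‖ ≤ ‖(2 : ℝ) ^ s * (1 + ‖x‖) ^ (-s)‖ := by
    rw [Real.norm_of_nonneg (radialTail_nonneg s x), Real.norm_of_nonneg (by positivity)]
    by_cases hx : 1 < ‖x‖
    · rw [radialTail, Set.indicator_of_mem (by exact hx)]
      calc
        -- Outside the unit ball `‖x‖ ≥ (1 + ‖x‖) / 2`, whence the constant `2^s`.
        ‖x‖ ^ (-s) ≤ ((1 + ‖x‖) / 2) ^ (-s) :=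
          Real.rpow_le_rpow_of_nonpos (by positivity) (by linarith) (by linarith)
        _ = _ := by
          rw [Real.div_rpow (by positivity) (by norm_num), Real.rpow_neg (by norm_num : (0 : ℝ) ≤ 2),
            div_inv_eq_mul, mul_comm]
    · rw [radialTail, Set.indicator_of_notMem (by exact hx)]
      positivity
  refine ne_top_of_le_ne_top ?_ (eLpNorm_mono hle)
  rcases eq_or_ne p ⊤ with rfl | hpt
  · rw [eLpNorm_exponent_top]
    refine ((eLpNormEssSup_le_of_ae_bound (C := (2 : ℝ) ^ s) ?_).trans_lt ENNReal.ofReal_lt_top).ne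
    refine Filter.Eventually.of_forall fun x => ?_
    rw [Real.norm_of_nonneg (by positivity)]
    exact mul_le_of_le_one_right (by positivity)
      (Real.rpow_le_one_of_one_le_of_nonpos (by linarith [norm_nonneg x]) (by linarith))
  · have hq0 := ENNReal.toReal_pos hp hpt
    rw [← lt_top_iff_ne_top, eLpNorm_lt_top_iff_lintegral_rpow_enorm_lt_top hp hpt]
    have hint := (integrable_one_add_norm (μ := (volume : Measure (EuclideanSpace ℝ (Fin n))))
      (r := s * p.toReal) (by
        rw [ENNReal.toReal_inv, ← div_eq_mul_inv, div_lt_iff₀ hq0] at hs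
        rwa [finrank_euclideanSpace_fin])).const_mul (((2 : ℝ) ^ s) ^ p.toReal)
    refine lt_of_eq_of_lt (lintegral_congr fun x => ?_) hint.2
    rw [Real.enorm_of_nonneg (by positivity), Real.enorm_of_nonneg (by positivity),
      ENNReal.ofReal_rpow_of_nonneg (by positivity) hq0.le,
      Real.mul_rpow (by positivity) (by positivity),
      ← Real.rpow_mul (by positivity : 0 ≤ 1 + ‖x‖), neg_mul]

theorem eLpNorm_radialTail_ne_zero (hn : 0 < n) {p : ℝ≥0∞} (hp : p ≠ 0) (s : ℝ) :
    eLpNorm (radialTail n s) p volume ≠ 0 := by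
  rw [Ne, eLpNorm_eq_zero_iff (measurable_radialTail s).aestronglyMeasurable hp]
  intro h
  have hO : IsOpen {x : EuclideanSpace ℝ (Fin n) | 1 < ‖x‖} := isOpen_lt continuous_const
    continuous_norm
  refine (hO.measure_pos volume ⟨EuclideanSpace.single ⟨0, hn⟩ 2, ?_⟩).ne'
    (measure_mono_null (fun x hx => ?_) h)
  · simp
  · have hx' : 1 < ‖x‖ := hx
    have h0 : 0 < ‖x‖ := by linarith
    change radialTail n s x ≠ 0
    rw [radialTail, Set.indicator_of_mem hx]
    positivity

theorem enorm_integral_ofReal {𝕜 X : Type*} [RCLike 𝕜] [MeasurableSpace X] {m : Measure X}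
    {b : X → ℝ} (hb : ∀ x, 0 ≤ b x) (hi : Integrable (fun x => (b x : 𝕜)) m) :
    ‖∫ x, (b x : 𝕜) ∂m‖ₑ = ∫⁻ x, ‖b x‖ₑ ∂m := by
  have hi' : Integrable b m := by
    refine hi.re.congr (Filter.Eventually.of_forall fun x => ?_)
    simp
  rw [integral_ofReal, ← ofReal_norm, RCLike.norm_ofReal, abs_of_nonneg (integral_nonneg hb),
    ofReal_integral_eq_lintegral_ofReal hi' (Filter.Eventually.of_forall hb)]
  exact lintegral_congr fun x => (Real.enorm_of_nonneg (hb x)).symm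

theorem enorm_rclike_ofReal {𝕜 : Type*} [RCLike 𝕜] (b : ℝ) : ‖(b : 𝕜)‖ₑ = ‖b‖ₑ := by
  rw [← ofReal_norm, RCLike.norm_ofReal, ← Real.norm_eq_abs, ofReal_norm]

variable {𝕜 : Type*} [RCLike 𝕜]

/-- The weight `|x|^μ` turns the tail of exponent `r` into that of exponent `r - μ > n/p`, of finite
norm. Nonnegativity and absolute convergence identify the norm of the transform with the integral of
norms, so the lower bound for nonnegative functions applies. -/
theorem eLpNorm_kPlaneTransform_radialTail (hkn : k < n) {p : ℝ≥0∞} (hp : 1 ≤ p) {μ ν r : ℝ}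
    (hν : ν + k = k * (p⁻¹).toReal + μ) (hμ : (k : ℝ) < μ + n * (p⁻¹).toReal)
    (hr : μ + n * (p⁻¹).toReal < r) :
    ENNReal.ofReal (kPlaneNorm n k (p⁻¹).toReal r) * eLpNorm (radialTail n (r - μ)) p volume ≤
      eLpNorm (fun τ => τ.dist ^ ν • kPlaneTransform (fun x => (radialTail n r x : 𝕜)) τ) p
        (affGrassMeasure hkn.le) := by
  have hp0 := (zero_lt_one.trans_le hp).ne'
  have hF : Measurable fun x => ‖radialTail n r x‖ₑ := (measurable_radialTail r).enorm
  have hle := le_eLpNorm_kPlane hkn hp (r := r) hν hF fun x x' s hs h => by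
    rw [Real.enorm_of_nonneg (radialTail_nonneg r x), Real.enorm_of_nonneg (radialTail_nonneg r x'),
      ← ENNReal.ofReal_mul (by positivity)]
    exact ENNReal.ofReal_le_ofReal (radialTail_mul_le hs h)
  rw [lintegral_mul_eq_kPlaneNorm hkn _ ENNReal.toReal_nonneg (hμ.trans hr)] at hle
  have hN : eLpNorm (fun x => ‖x‖ₑ ^ μ * ‖radialTail n r x‖ₑ) p volume =
      eLpNorm (radialTail n (r - μ)) p volume := by
    simp only [enorm_rpow_mul_radialTail]
    exact eLpNorm_congr_enorm_ae (Filter.Eventually.of_forall fun x => enorm_eq_self _)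
  have hs : n * (p⁻¹).toReal < r - μ := by linarith
  rw [hN] at hle
  refine hle.trans (le_of_eq ?_)
  rw [AffGrass.eLpNorm_dist_rpow_smul hkn]
  refine eLpNorm_congr_ae ?_
  filter_upwards [ae_integrable_kPlane hkn hp hν hμ (f := fun x => (radialTail n r x : 𝕜))
    (RCLike.continuous_ofReal.measurable.comp (measurable_radialTail r)).stronglyMeasurable (by
      simp only [enorm_rclike_ofReal]
      rw [hN]
      exact eLpNorm_radialTail_ne_top hp0 (le_trans (by positivity) hs.le) hs)] with τ hτ
  rw [kPlaneTransform, enorm_integral_ofReal (fun y => radialTail_nonneg r _) hτ]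

theorem kPlaneNorm_le_of_forall (hkn : k < n) {p : ℝ≥0∞} [hp : Fact (1 ≤ p)] {μ ν : ℝ}
    (hν : ν + k = k * (p⁻¹).toReal + μ) (hμ : (k : ℝ) < μ + n * (p⁻¹).toReal) {C : ℝ} (hC : 0 ≤ C)
    (h : ∀ f, ‖kPlaneLp 𝕜 hkn hp.out hν hμ f‖ ≤ C * ‖f‖) :
    kPlaneNorm n k (p⁻¹).toReal (μ + n * (p⁻¹).toReal) ≤ C := by
  have hp0 := (zero_lt_one.trans_le hp.out).ne'
  -- The limit is taken from the right: for finite `p` the tail leaves the space at `r = μ + n/p`,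
  -- while the constant is continuous there.
  refine le_of_tendsto ((continuousAt_kPlaneNorm _ hμ).tendsto.mono_left
    (nhdsWithin_le_nhds (s := Set.Ioi (μ + n * (p⁻¹).toReal)))) ?_
  filter_upwards [self_mem_nhdsWithin] with r hr
  have hr' : μ + n * (p⁻¹).toReal < r := hr
  have hs : n * (p⁻¹).toReal < r - μ := by linarith
  have hm : StronglyMeasurable fun x => (radialTail n r x : 𝕜) :=
    (RCLike.continuous_ofReal.measurable.comp (measurable_radialTail r)).stronglyMeasurable
  have hae := AEEqFun.coeFn_mk _ (hm.aestronglyMeasurable (μ := volume))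
  have hN : eLpNorm (fun x => ‖x‖ ^ μ • (radialTail n r x : 𝕜)) p volume =
      eLpNorm (radialTail n (r - μ)) p volume := by
    rw [eLpNorm_norm_rpow_smul p μ (EuclideanSpace.ae_ne_zero (by omega))]
    simp only [enorm_rclike_ofReal, enorm_rpow_mul_radialTail]
    exact eLpNorm_congr_enorm_ae (Filter.Eventually.of_forall fun x => enorm_eq_self _)
  have hfin := eLpNorm_radialTail_ne_top hp0 (le_trans (by positivity) hs.le) hs
  let f : weightedLp 𝕜 (fun x : EuclideanSpace ℝ (Fin n) => ‖x‖ ^ μ) p volume :=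
    ⟨AEEqFun.mk _ hm.aestronglyMeasurable, by
      refine MemLp.ae_eq (f := fun x => ‖x‖ ^ μ • (radialTail n r x : 𝕜)) ?_
        ⟨((measurable_norm.pow_const μ).stronglyMeasurable.smul hm).aestronglyMeasurable, ?_⟩
      · filter_upwards [hae] with x hx
        rw [hx]
      · rw [hN]
        exact hfin.lt_top⟩
  have hf : ENNReal.ofReal ‖f‖ = eLpNorm (radialTail n (r - μ)) p volume := by
    rw [weightedLp.enorm_eq, ← hN]
    refine eLpNorm_congr_ae ?_
    filter_upwards [hae] with x hx
    rw [← hx]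
  have hlow := eLpNorm_kPlaneTransform_radialTail (𝕜 := 𝕜) hkn hp.out hν hμ hr'
  have hup := ENNReal.ofReal_le_ofReal (h f)
  rw [ENNReal.ofReal_mul hC, hf, enorm_kPlaneLp] at hup
  have hT : eLpNorm (fun τ => τ.dist ^ ν • kPlaneTransform (fun x => (radialTail n r x : 𝕜)) τ) p
        (affGrassMeasure hkn.le) =
      eLpNorm (fun τ => τ.dist ^ ν •
        kPlaneTransform (f : EuclideanSpace ℝ (Fin n) →ₘ[volume] 𝕜) τ) p
        (affGrassMeasure hkn.le) := by
    refine eLpNorm_congr_ae ?_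
    filter_upwards [ae_ae_eq_kPlane hkn hae] with τ hτ
    rw [kPlaneTransform, kPlaneTransform, integral_congr_ae hτ]
  have := hlow.trans (hT.le.trans hup)
  -- The norm of the tail is finite and nonzero, so it cancels.
  rwa [ENNReal.mul_le_mul_iff_left (eLpNorm_radialTail_ne_zero (by omega) hp0 _) hfin,
    ENNReal.ofReal_le_ofReal_iff hC] at this

end TestFunction

/-- The quantifier over all representatives `φ` makes convergence and the value of `T f` statements
about actual functions, independent of the choice in the class. -/
theorem theorem1p1 {𝕜 : Type*} [RCLike 𝕜] {n k : ℕ} (hk : 1 ≤ k) (hkn : k < n)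
    {p p' : ℝ≥0∞} [Fact (1 ≤ p)] (hpp' : p⁻¹ + p'⁻¹ = 1) {μ ν : ℝ}
    (hν : ν = μ - k * (p'⁻¹).toReal) (hμ : k - n * (p⁻¹).toReal < μ) :
    ∃ T : weightedLp 𝕜 (fun x : EuclideanSpace ℝ (Fin n) => ‖x‖ ^ μ) p volume →L[𝕜]
        weightedLp 𝕜 (fun τ : AffGrass n k => τ.dist ^ ν) p (affGrassMeasure hkn.le),
      (∀ (f : weightedLp 𝕜 (fun x : EuclideanSpace ℝ (Fin n) => ‖x‖ ^ μ) p volume)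
        (φ : EuclideanSpace ℝ (Fin n) → 𝕜),
        φ =ᵐ[volume] (f : EuclideanSpace ℝ (Fin n) →ₘ[volume] 𝕜) →
          (∀ᵐ τ ∂affGrassMeasure hkn.le,
            Integrable (fun y : τ.1.1.1 => φ (y.1 + τ.1.2)) volume) ∧
          (T f : AffGrass n k →ₘ[affGrassMeasure hkn.le] 𝕜) =ᵐ[affGrassMeasure hkn.le]
            kPlaneTransform φ) ∧
      ‖T‖ = Real.pi ^ ((k : ℝ) / 2) * (sphereArea (n - k) / sphereArea n) ^ (p⁻¹).toReal *
        (Real.Gamma ((μ + n * (p⁻¹).toReal - k) / 2) /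
          Real.Gamma ((μ + n * (p⁻¹).toReal) / 2)) := by
  rename_i hp
  have hadd : (p⁻¹).toReal + (p'⁻¹).toReal = 1 := by
    rw [← ENNReal.toReal_add (ne_top_of_le_ne_top ENNReal.one_ne_top (hpp' ▸ le_self_add))
      (ne_top_of_le_ne_top ENNReal.one_ne_top (hpp' ▸ le_add_self)), hpp', ENNReal.toReal_one]
  -- Eliminating `1/p' = 1 - 1/p` gives the balance of powers of `|v|`.
  have hν' : ν + k = k * (p⁻¹).toReal + μ := by
    rw [hν]
    linear_combination (-(k : ℝ)) * hadd
  have hμ' : (k : ℝ) < μ + n * (p⁻¹).toReal := by linarith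
  have h0 := (kPlaneNorm_pos hkn (p⁻¹).toReal hμ').le
  refine ⟨(kPlaneLp 𝕜 hkn hp.out hν' hμ').mkContinuous _ (norm_kPlaneLp_le hkn hν' hμ'),
    fun f φ hφ => ⟨?_, ?_⟩, le_antisymm (LinearMap.mkContinuous_norm_le _ h0 _) ?_⟩
  · filter_upwards [ae_ae_eq_kPlane hkn hφ, ae_integrable_kPlane hkn hp.out hν' hμ'
      f.1.stronglyMeasurable (weightedLp.eLpNorm_enorm_ne_top (by omega) f)] with τ h1 h2
    exact h2.congr h1.symm
  · filter_upwards [coeFn_kPlaneLp hkn hp.out hν' hμ' f, ae_ae_eq_kPlane hkn hφ] with τ h1 h2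
    refine Eq.trans h1 ?_
    rw [kPlaneTransform, kPlaneTransform, integral_congr_ae h2]
  · exact kPlaneNorm_le_of_forall hkn hν' hμ' (norm_nonneg _)
      ((kPlaneLp 𝕜 hkn hp.out hν' hμ').mkContinuous _ (norm_kPlaneLp_le hkn hν' hμ')).le_opNorm
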